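/- Let $(M,D,g)$ be a time-oriented sub-Lorentzian manifold: $M$ is a smooth finite-dimensional manifold, $D\subset TM$ is a smooth distribution of constant rank, $g$ is a smoothly varying Lorentzian metric on $D$ (symmetric, nondegenerate, of index $1$), and the time orientation $X$ is a continuous vector field with $X(p)\in D_p$ and $g(X(p),X(p))<0$ for all $p\in M$. A vector $v\in D_p$ is timelike if $g(v,v)<0$ and nonspacelike if $g(v,v)\le 0$; a nonspacelike $v$ is future directed if $g(v,X(p))<0$. An absolutely continuous curve $\gamma$ is a timelike (nonspacelike) future directed curve if for almost every $t$ the derivative $\gamma'(t)$ exists, lies in $D_{\gamma(t)}$ and is timelike (nonspacelike) and future directed. The length of a nonspacelike future directed curve $\eta:[\alpha,\beta]\to M$ is $\ell(\eta)=\int_\alpha^\beta|g(\eta'(s),\eta'(s))|^{1/2}\,ds$. For $U\subset M$ and $q_1,q_2\in U$ let $d_U(q_1,q_2)$ be the supremum of the lengths of the nonspacelike future directed curves that are contained in $U$ and lead from $q_1$ to $q_2$ ($0$ if there are none). Such a curve is a $U$-maximizer if its length equals $d_U(q_1,q_2)$; it is the unique $U$-maximizer connecting its endpoints if moreover every $U$-maximizer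 from $q_1$ to $q_2$ is an orientation-preserving reparametrization of it. The sub-Lorentzian Hamiltonian $H:T^*M\to\mathbb R$ is given, for any local $g$-orthonormal frame $X_1,\dots,X_r$ of $D$ with $X_1$ timelike, by $$H(x,\lambda)=-\tfrac12\langle\lambda,X_1(x)\rangle^2+\tfrac12\sum_{i=2}^r\langle\lambda,X_i(x)\rangle^2 .$$ A curve $\gamma:[a,b]\to M$ is a normal extremal if it has a lift $\Gamma:[a,b]\to T^*M$ that solves the Hamiltonian system of $H$. **Theorem.** Let $a<b$ and let $\gamma:[a,b]\to M$ be a timelike future directed normal extremal. Then every $t\in[a,b]$ admits an open neighbourhood $U$ of $\gamma(t)$ with the following property. Let $J$ be the connected component of $\{s\in[a,b]:\gamma(s)\in U\}$ that contains $t$. For all $s_1<s_2$ in $J$, the arc $\gamma|_{[s_1,s_2]}$ is the unique $U$-maximizer connecting its endpoints $\gamma(s_1)$ and $\gamma(s_2)$. -/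

import Mathlib

open Set Filter Topology MeasureTheory
open scoped Manifold ContDiff ENNReal

noncomputable section

/-- The cotangent space `T*_p M` at a point of a manifold `M` modelled on `E`. -/
abbrev CotangentSpaceAt (E : Type*) [NormedAddCommGroup E] [NormedSpace ℝ E]
    {M : Type*} [TopologicalSpace M] [ChartedSpace E M] (p : M) : Type _ :=
  TangentSpace 𝓘(ℝ, E) p →L[ℝ] ℝ

instance TangentSpace.finiteDimensional_modelSpace (E : Type*) [NormedAddCommGroup E]
    [NormedSpace ℝ E] [FiniteDimensional ℝ E]
    {M : Type*} [TopologicalSpace M] [ChartedSpace E M] (p : M) :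
    FiniteDimensional ℝ (TangentSpace 𝓘(ℝ, E) p) :=
  inferInstanceAs (FiniteDimensional ℝ E)

/-- A time-oriented sub-Lorentzian structure `(D, g)` on the smooth manifold `M`, which is
modelled on the finite-dimensional space `E` (so that `dim M = dim E`): a smooth distribution `D` of constant rank, a smoothly varying Lorentzian metric `g` on `D` (symmetric,
nondegenerate, of index one), and a time orientation `X`, that is, a continuous timelike
(in particular horizontal) vector field. -/
structure SubLorentzianStructure (E : Type*) [NormedAddCommGroup E] [NormedSpace ℝ E]
    [FiniteDimensional ℝ E] (M : Type*) [TopologicalSpace M] [ChartedSpace E M] [IsManifold 𝓘(ℝ, E) ∞ M] where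
  /-- The rank of the distribution. -/
  rank : ℕ
  /-- The distribution. -/
  D : ∀ p : M, Submodule ℝ (TangentSpace 𝓘(ℝ, E) p)
  /-- The metric on the distribution. -/
  g : ∀ p : M, LinearMap.BilinForm ℝ (D p)
  /-- The time orientation. -/
  X : ∀ p : M, D p
  /-- The metric is symmetric. -/
  symm : ∀ p, (g p).IsSymm
  /-- The metric is nondegenerate. -/
  nondegenerate : ∀ p, (g p).Nondegenerate
  /-- The metric has index one. -/
  index_eq_one : ∀ p, sigNeg (LinearMap.BilinMap.toQuadraticMap (g p)) = 1
  /-- Near every point, `D` has a smooth frame, in which the coefficients of `g` are smooth. -/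
  exists_smooth_frame : ∀ p₀ : M, ∃ U : Set M, IsOpen U ∧ p₀ ∈ U ∧
    ∃ Y : Fin rank → ∀ p : M, D p,
      (∀ i, ContMDiffOn 𝓘(ℝ, E) 𝓘(ℝ, E).tangent ∞
        (fun p => (⟨p, (Y i p : TangentSpace 𝓘(ℝ, E) p)⟩ : TangentBundle 𝓘(ℝ, E) M)) U) ∧
      (∀ p ∈ U, LinearIndependent ℝ (fun i => Y i p) ∧
        Submodule.span ℝ (Set.range fun i => Y i p) = ⊤) ∧
      ∀ i j, ContMDiffOn 𝓘(ℝ, E) 𝓘(ℝ, ℝ) ∞ (fun p => g p (Y i p) (Y j p)) U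
  /-- The time orientation is continuous. -/
  continuous_X : Continuous
    (fun p => (⟨p, (X p : TangentSpace 𝓘(ℝ, E) p)⟩ : TangentBundle 𝓘(ℝ, E) M))
  /-- The time orientation is timelike. -/
  timelike_X : ∀ p, g p (X p) (X p) < 0

/-- The velocity vector `γ'(t)` of a curve. -/
def curveVelocity (E : Type*) [NormedAddCommGroup E] [NormedSpace ℝ E]
    {M : Type*} [TopologicalSpace M] [ChartedSpace E M] (γ : ℝ → M) (t : ℝ) : TangentSpace 𝓘(ℝ, E) (γ t) :=
  mfderiv 𝓘(ℝ, ℝ) 𝓘(ℝ, E) γ t (1 : ℝ)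

/-- Absolute continuity of the curve `γ : [α, β] → M`: it is continuous, and its expression in a
chart is absolutely continuous on every closed subinterval that is mapped into the chart domain. -/
def IsAbsolutelyContinuousCurve (E : Type*) [NormedAddCommGroup E] [NormedSpace ℝ E]
    {M : Type*} [TopologicalSpace M] [ChartedSpace E M] (γ : ℝ → M) (α β : ℝ) : Prop :=
  ContinuousOn γ (Icc α β) ∧
    ∀ (x₀ : M) (s₁ s₂ : ℝ), α ≤ s₁ → s₁ ≤ s₂ → s₂ ≤ β →
      (∀ s ∈ Icc s₁ s₂, γ s ∈ (chartAt E x₀).source) →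
      AbsolutelyContinuousOnInterval (fun s => extChartAt 𝓘(ℝ, E) x₀ (γ s)) s₁ s₂

/-- The curve `η : [α, β] → M` is an orientation-preserving reparametrization of
`γ : [s₁, s₂] → M`. -/
def IsReparametrization {M : Type*} (η : ℝ → M) (α β : ℝ) (γ : ℝ → M) (s₁ s₂ : ℝ) : Prop :=
  ∃ σ : ℝ → ℝ, ContinuousOn σ (Icc α β) ∧ StrictMonoOn σ (Icc α β) ∧ σ α = s₁ ∧ σ β = s₂ ∧
    ∀ s ∈ Icc α β, η s = γ (σ s)

/-- The components, in the canonical coordinates induced on `T*M` by the chart at `x₀`, of a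
covector `ξ` at a point `p` of the chart domain: `ξ ∘ (dφ_p)⁻¹`, where `φ` is the chart. -/
def covectorInChart (E : Type*) [NormedAddCommGroup E] [NormedSpace ℝ E]
    {M : Type*} [TopologicalSpace M] [ChartedSpace E M] (x₀ p : M) (ξ : CotangentSpaceAt E p) :
    E →L[ℝ] ℝ :=
  ξ ∘L (mfderiv 𝓘(ℝ, E) 𝓘(ℝ, E) (extChartAt 𝓘(ℝ, E) x₀) p).inverse

namespace SubLorentzianStructure

variable {E : Type*} [NormedAddCommGroup E] [NormedSpace ℝ E]
    [FiniteDimensional ℝ E] {M : Type*} [TopologicalSpace M]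
  [ChartedSpace E M] [IsManifold 𝓘(ℝ, E) ∞ M]

/-- `v` is horizontal and timelike: `g(v, v) < 0`. -/
def IsTimelike (S : SubLorentzianStructure E M) (p : M) (v : TangentSpace 𝓘(ℝ, E) p) : Prop :=
  ∃ h : v ∈ S.D p, S.g p ⟨v, h⟩ ⟨v, h⟩ < 0

/-- `v` is horizontal and nonspacelike: `g(v, v) ≤ 0`. -/
def IsNonspacelike (S : SubLorentzianStructure E M) (p : M) (v : TangentSpace 𝓘(ℝ, E) p) : Prop :=
  ∃ h : v ∈ S.D p, S.g p ⟨v, h⟩ ⟨v, h⟩ ≤ 0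

/-- `v` is horizontal and `g(v, X) < 0` for the time orientation `X`. For nonspacelike `v` this
says that `v` is future directed. -/
def IsFutureDirected (S : SubLorentzianStructure E M) (p : M)
    (v : TangentSpace 𝓘(ℝ, E) p) : Prop :=
  ∃ h : v ∈ S.D p, S.g p ⟨v, h⟩ (S.X p) < 0

open Classical in
/-- `‖v‖ = √|g(v, v)|` for horizontal `v` (and `0` for other vectors). -/
def vnorm (S : SubLorentzianStructure E M) (p : M) (v : TangentSpace 𝓘(ℝ, E) p) : ℝ :=
  if h : v ∈ S.D p then √|S.g p ⟨v, h⟩ ⟨v, h⟩| else 0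

/-- `γ : [α, β] → M` is an absolutely continuous, timelike future directed horizontal curve. -/
def IsTimelikeFDCurve (S : SubLorentzianStructure E M) (γ : ℝ → M) (α β : ℝ) : Prop :=
  IsAbsolutelyContinuousCurve E γ α β ∧
    ∀ᵐ t ∂(volume.restrict (Icc α β)), MDifferentiableAt 𝓘(ℝ, ℝ) 𝓘(ℝ, E) γ t ∧
      S.IsTimelike (γ t) (curveVelocity E γ t) ∧ S.IsFutureDirected (γ t) (curveVelocity E γ t)

/-- `γ : [α, β] → M` is an absolutely continuous, nonspacelike future directed horizontal curve. -/
def IsNonspacelikeFDCurve (S : SubLorentzianStructure E M) (γ : ℝ → M) (α β : ℝ) : Prop :=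
  IsAbsolutelyContinuousCurve E γ α β ∧
    ∀ᵐ t ∂(volume.restrict (Icc α β)), MDifferentiableAt 𝓘(ℝ, ℝ) 𝓘(ℝ, E) γ t ∧
      S.IsNonspacelike (γ t) (curveVelocity E γ t) ∧
      S.IsFutureDirected (γ t) (curveVelocity E γ t)

/-- The sub-Lorentzian length `∫ ‖γ'(t)‖ dt` of `γ : [α, β] → M`. -/
def length (S : SubLorentzianStructure E M) (γ : ℝ → M) (α β : ℝ) : ℝ≥0∞ :=
  ∫⁻ t in Icc α β, ENNReal.ofReal (S.vnorm (γ t) (curveVelocity E γ t))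

/-- `η : [α, β] → M` belongs to `H_U(q₁, q₂)`: it is a nonspacelike future directed curve
contained in `U` that joins `q₁` to `q₂`. -/
def IsJoiningCurve (S : SubLorentzianStructure E M) (U : Set M) (q₁ q₂ : M)
    (η : ℝ → M) (α β : ℝ) : Prop :=
  α < β ∧ S.IsNonspacelikeFDCurve η α β ∧ (∀ s ∈ Icc α β, η s ∈ U) ∧ η α = q₁ ∧ η β = q₂

/-- The sub-Lorentzian distance `d_U(q₁, q₂)`: the supremum of the lengths of the curves in
`H_U(q₁, q₂)`, and `0` if there are none. -/
def dist (S : SubLorentzianStructure E M) (U : Set M) (q₁ q₂ : M) : ℝ≥0∞ :=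
  ⨆ (η : ℝ → M) (α : ℝ) (β : ℝ) (_ : S.IsJoiningCurve U q₁ q₂ η α β), S.length η α β

/-- `η : [α, β] → M` is a nonspacelike future directed curve in `U` that realizes the
`U`-distance between its endpoints. -/
def IsMaximizer (S : SubLorentzianStructure E M) (U : Set M) (η : ℝ → M) (α β : ℝ) : Prop :=
  S.IsJoiningCurve U (η α) (η β) η α β ∧ S.length η α β = S.dist U (η α) (η β)

/-- `γ : [s₁, s₂] → M` is a `U`-maximizer, and every `U`-maximizer with the same endpoints is a
reparametrization of it. -/
def IsUniqueMaximizer (S : SubLorentzianStructure E M) (U : Set M) (γ : ℝ → M)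
    (s₁ s₂ : ℝ) : Prop :=
  S.IsMaximizer U γ s₁ s₂ ∧
    ∀ (η : ℝ → M) (α β : ℝ), S.IsMaximizer U η α β → η α = γ s₁ → η β = γ s₂ →
      IsReparametrization η α β γ s₁ s₂

/-- The horizontal vector `ξ^♯ ∈ D_p` with `g(ξ^♯, w) = ⟨ξ, w⟩` for all `w ∈ D_p`. -/
def sharp (S : SubLorentzianStructure E M) (p : M) (ξ : CotangentSpaceAt E p) : S.D p :=
  ((S.g p).toDual (S.nondegenerate p)).symm
    ((ξ : TangentSpace 𝓘(ℝ, E) p →ₗ[ℝ] ℝ) ∘ₗ (S.D p).subtype)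

theorem g_sharp (S : SubLorentzianStructure E M) (p : M) (ξ : CotangentSpaceAt E p) (w : S.D p) :
    S.g p (S.sharp p ξ) w = ξ (w : TangentSpace 𝓘(ℝ, E) p) := by
  rw [sharp, LinearMap.BilinForm.apply_toDual_symm_apply]
  rfl

/-- The sub-Lorentzian Hamiltonian `H(p, ξ) = ½ g(ξ^♯, ξ^♯)`; by `hamiltonian_eq` it is
`-½ ⟨ξ, X₁⟩² + ½ ∑_{i ≥ 2} ⟨ξ, X_i⟩²` for any orthonormal basis of `D_p` with `X₁` timelike. -/
def hamiltonian (S : SubLorentzianStructure E M) (p : M) (ξ : CotangentSpaceAt E p) : ℝ :=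
  (1 / 2) * S.g p (S.sharp p ξ) (S.sharp p ξ)

theorem hamiltonian_eq (S : SubLorentzianStructure E M) (p : M) (ξ : CotangentSpaceAt E p)
    {k : ℕ} (e : Module.Basis (Fin (k + 1)) ℝ (S.D p))
    (he₀ : S.g p (e 0) (e 0) = -1) (he₁ : ∀ i : Fin k, S.g p (e i.succ) (e i.succ) = 1)
    (he : ∀ i j, i ≠ j → S.g p (e i) (e j) = 0) :
    S.hamiltonian p ξ = -(1 / 2) * ξ (e 0 : TangentSpace 𝓘(ℝ, E) p) ^ 2 +
      (1 / 2) * ∑ i : Fin k, ξ (e i.succ : TangentSpace 𝓘(ℝ, E) p) ^ 2 := by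
  have key : ∀ i, ξ (e i : TangentSpace 𝓘(ℝ, E) p)
      = e.repr (S.sharp p ξ) i * S.g p (e i) (e i) := by
    intro i
    rw [← S.g_sharp p ξ (e i)]
    conv_lhs => rw [← e.sum_repr (S.sharp p ξ)]
    simp only [map_sum, map_smul, LinearMap.sum_apply, LinearMap.smul_apply, smul_eq_mul]
    rw [Finset.sum_eq_single i]
    · intro j _ hj
      rw [he j i hj, mul_zero]
    · simp
  have h2 : S.g p (S.sharp p ξ) (S.sharp p ξ)
      = ∑ i, e.repr (S.sharp p ξ) i * ξ (e i : TangentSpace 𝓘(ℝ, E) p) := by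
    have h3 := congrArg (fun w : S.D p => ξ (w : TangentSpace 𝓘(ℝ, E) p))
      (e.sum_repr (S.sharp p ξ))
    simp only [Submodule.coe_sum, Submodule.coe_smul, map_sum, map_smul, smul_eq_mul] at h3
    rw [S.g_sharp p ξ, h3]
  rw [hamiltonian, h2, Fin.sum_univ_succ, key 0, he₀]
  simp only [key (Fin.succ _), he₁]
  ring_nf

/-- The Hamiltonian in the canonical coordinates `(x, ξ)` on `T*M` induced by the chart `φ` at
`x₀`. -/
def chartHamiltonian (S : SubLorentzianStructure E M) (x₀ : M)
    (x : E) (ξ : E →L[ℝ] ℝ) : ℝ :=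
  S.hamiltonian ((extChartAt 𝓘(ℝ, E) x₀).symm x)
    (ξ ∘L mfderiv 𝓘(ℝ, E) 𝓘(ℝ, E) (extChartAt 𝓘(ℝ, E) x₀)
      ((extChartAt 𝓘(ℝ, E) x₀).symm x))

/-- The curve `Γ(t) = (γ(t), lam(t))` in `T*M`, `t ∈ [a, b]`, solves the Hamiltonian system of the
sub-Lorentzian Hamiltonian: in all the canonical coordinates `(x, ξ)` induced by the charts,
`x' = ∂H/∂ξ` and `ξ' = -∂H/∂x`. -/
def IsHamiltonianTrajectory (S : SubLorentzianStructure E M) (γ : ℝ → M)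
    (lam : ∀ t : ℝ, CotangentSpaceAt E (γ t)) (a b : ℝ) : Prop :=
  ContinuousOn γ (Icc a b) ∧
    ∀ x₀ : M, ∀ t ∈ Icc a b, γ t ∈ (chartAt E x₀).source →
      (∃ v : E,
        HasDerivWithinAt (fun s => extChartAt 𝓘(ℝ, E) x₀ (γ s)) v (Icc a b) t ∧
        ∀ ζ : E →L[ℝ] ℝ,
          ζ v = fderiv ℝ (fun ξ => S.chartHamiltonian x₀ (extChartAt 𝓘(ℝ, E) x₀ (γ t)) ξ)
            (covectorInChart E x₀ (γ t) (lam t)) ζ) ∧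
      HasDerivWithinAt (fun s => covectorInChart E x₀ (γ s) (lam s))
        (-fderiv ℝ
          (fun x => S.chartHamiltonian x₀ x (covectorInChart E x₀ (γ t) (lam t)))
          (extChartAt 𝓘(ℝ, E) x₀ (γ t)))
        (Icc a b) t

/-- `γ : [a, b] → M` is a normal extremal: it has a lift to `T*M` that solves the Hamiltonian
system of the sub-Lorentzian Hamiltonian. -/
def IsNormalExtremal (S : SubLorentzianStructure E M) (γ : ℝ → M) (a b : ℝ) : Prop :=
  ∃ lam : ∀ t : ℝ, CotangentSpaceAt E (γ t), S.IsHamiltonianTrajectory γ lam a b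

end SubLorentzianStructure

end

/-! The proof is a calibration argument in the chart at `γ t`. Let `(X, P)` be the lift of the
extremal in canonical coordinates and `h < 0` the constant value of `H` along it. It suffices to
find near `X t` a function `f` with differential `F` such that `H(x, F x) + ‖x - X (θ x)‖² ≤ h` and
`f (X s) = 2h(s - t)`, where `θ` is a local time function with `θ (X s) = s`. If moreover `F` is
negative on the time orientation, the reverse Cauchy-Schwarz inequality gives `F v ≤ -√(-2h) ‖v‖`
for nonspacelike future directed `v`. Integrating this along a curve from `q₁` to `q₂` bounds its
length by `(f q₁ - f q₂)/√(-2h)`, and arcs of the extremal attain the bound. A curve that attains it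
has `H(x, F x) = h` almost everywhere, so the square vanishes and the curve runs on the extremal,
with `θ` as its new parameter (`joiningCurve_of_calibration`, `isUniqueMaximizer_of_calibration`).

Only a subsolution of the Hamilton-Jacobi equation is needed, so no field of extremals has to be
constructed. An explicit choice works (`exists_calibration`): with `y = x - X θ`, put `f = 2h(θ - t)
+ P(θ) y - (K/2)(θ - t)|y|²` for a Euclidean norm `|·|`. The first two terms give the right value
and differential on the curve. The time derivative of the last term contributes `-(K/2)|y|²` to
`H(x, F x)`, and for large `K` this beats the second order Taylor error of `H`
(`hamiltonian_add_sq_le`). -/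

/-! ### Calibrations for a Hamiltonian on a normed space -/

theorem ContDiffAt.exists_ball_le_taylor {G : Type*} [NormedAddCommGroup G] [NormedSpace ℝ G]
    {H : G → ℝ} {z₀ : G} (hH : ContDiffAt ℝ 2 H z₀) :
    ∃ C ≥ 0, ∃ ρ > 0, ∀ z ∈ Metric.ball z₀ ρ, ∀ w ∈ Metric.ball z₀ ρ,
      H w ≤ H z + fderiv ℝ H z (w - z) + C * ‖w - z‖ ^ 2 := by
  have h1 : ContDiffAt ℝ 1 (fderiv ℝ H) z₀ := hH.fderiv_right (by norm_num)
  obtain ⟨K, N, hN, hK⟩ := h1.exists_lipschitzOnWith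
  have h2 : ∀ᶠ z in 𝓝 z₀, DifferentiableAt ℝ H z :=
    (hH.eventually (by simp)).mono fun z hz => hz.differentiableAt (by simp)
  obtain ⟨ρ, hρ, hb⟩ := Metric.mem_nhds_iff.mp (inter_mem hN h2)
  refine ⟨K, K.2, ρ, hρ, fun z hz w hw => ?_⟩
  have hseg : segment ℝ z w ⊆ Metric.ball z₀ ρ := (convex_ball z₀ ρ).segment_subset hz hw
  -- Mean value inequality for `H - DH(z)`, whose derivative is at most `K * ‖w - z‖` on the segment
  -- because `DH` is `K`-Lipschitz there.
  have := (convex_segment (𝕜 := ℝ) z w).norm_image_sub_le_of_norm_fderiv_le' (f := H)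
    (φ := fderiv ℝ H z) (C := K * ‖w - z‖)
    (fun x hx => (hb (hseg hx)).2) (fun x hx => by
      have h3 := hK.dist_le_mul x (hb (hseg hx)).1 z (hb hz).1
      rw [dist_eq_norm, dist_eq_norm] at h3
      refine h3.trans (mul_le_mul_of_nonneg_left ?_ K.2)
      exact norm_sub_le_of_mem_segment hx)
    (left_mem_segment ℝ z w) (right_mem_segment ℝ z w)
  rw [Real.norm_eq_abs] at this
  have := (le_abs_self _).trans this
  nlinarith

theorem exists_local_inverse_of_hasDerivAt {u u' : ℝ → ℝ} {t : ℝ}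
    (hu : ∀ᶠ s in 𝓝 t, HasDerivAt u (u' s) s) (hc : ContinuousAt u' t) (h0 : u' t ≠ 0) :
    ∃ ϑ : ℝ → ℝ, ϑ (u t) = t ∧ (∀ᶠ s in 𝓝 t, ϑ (u s) = s) ∧
      ∀ᶠ r in 𝓝 (u t), HasDerivAt ϑ (u' (ϑ r))⁻¹ r := by
  have hs : HasStrictDerivAt u (u' t) t := hasStrictDerivAt_of_hasDerivAt_of_continuousAt hu hc
  have hs' := hs.hasStrictFDerivAt_equiv h0
  let e := hs'.toOpenPartialHomeomorph u
  have he : ∀ s, e s = u s := fun s => rfl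
  have hte : t ∈ e.source := hs'.mem_toOpenPartialHomeomorph_source
  have hut : u t ∈ e.target := e.map_source hte
  have hsymm : e.symm (u t) = t := e.left_inv hte
  have hct : Tendsto e.symm (𝓝 (u t)) (𝓝 t) := by
    have := e.continuousAt_symm hut
    rwa [ContinuousAt, hsymm] at this
  refine ⟨e.symm, hsymm, ?_, ?_⟩
  · filter_upwards [e.open_source.mem_nhds hte] with s hs using e.left_inv hs
  · have hne : ∀ᶠ s in 𝓝 t, u' s ≠ 0 := hc.eventually_ne h0
    filter_upwards [e.open_target.mem_nhds hut, hct.eventually hu, hct.eventually hne]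
      with r hr h1 h2
    refine HasDerivAt.of_local_left_inverse (e.continuousAt_symm hr) h1 h2 ?_
    filter_upwards [e.open_target.mem_nhds hr] with q hq using e.right_inv hq

section Calibration

variable {E : Type*} [NormedAddCommGroup E] [NormedSpace ℝ E]

/-- Since `P (X') = 2h`, the differential of `2h(θ - t)` cancels against the one that `P(θ)`
produces from `-X(θ)`. What remains besides `P(θ)` is small with `x - X(θ)`. -/
theorem hasFDerivAt_calibration {W : Type*} [NormedAddCommGroup W] [InnerProductSpace ℝ W]
    (L : E →L[ℝ] W) (τ : E →L[ℝ] ℝ) {X X' : ℝ → E} {P P' : ℝ → E →L[ℝ] ℝ} {ϑ : ℝ → ℝ}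
    {t h K : ℝ} {x : E}
    (hϑ : HasDerivAt ϑ (τ (X' (ϑ (τ x))))⁻¹ (τ x))
    (hX : HasDerivAt X (X' (ϑ (τ x))) (ϑ (τ x)))
    (hP : HasDerivAt P (P' (ϑ (τ x))) (ϑ (τ x)))
    (hPX : P (ϑ (τ x)) (X' (ϑ (τ x))) = 2 * h) :
    HasFDerivAt (fun x => 2 * h * (ϑ (τ x) - t) + P (ϑ (τ x)) (x - X (ϑ (τ x)))
        - K / 2 * ((ϑ (τ x) - t) * ‖L (x - X (ϑ (τ x)))‖ ^ 2))
      (P (ϑ (τ x)) +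
        ((P' (ϑ (τ x)) (x - X (ϑ (τ x))) - K / 2 * ‖L (x - X (ϑ (τ x)))‖ ^ 2) •
            ((τ (X' (ϑ (τ x))))⁻¹ • τ)
          - (K * (ϑ (τ x) - t)) • (innerSL ℝ (L (x - X (ϑ (τ x)))) ∘L L ∘L
            (ContinuousLinearMap.id ℝ E -
              ((τ (X' (ϑ (τ x))))⁻¹ • τ).smulRight (X' (ϑ (τ x))))))) x := by
  have hθ : HasFDerivAt (fun x => ϑ (τ x)) ((τ (X' (ϑ (τ x))))⁻¹ • τ) x :=
    hϑ.comp_hasFDerivAt x τ.hasFDerivAt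
  have hXθ : HasFDerivAt (fun x => X (ϑ (τ x))) _ x := hX.hasFDerivAt.comp x hθ
  have hPθ : HasFDerivAt (fun x => P (ϑ (τ x))) _ x := hP.hasFDerivAt.comp x hθ
  have hY : HasFDerivAt (fun x => x - X (ϑ (τ x))) _ x := (hasFDerivAt_id x).sub hXθ
  have hLY : HasFDerivAt (fun x => L (x - X (ϑ (τ x)))) _ x := L.hasFDerivAt.comp x hY
  have hθt := hθ.sub_const t
  refine (((hθt.const_mul (2 * h)).add (hPθ.clm_apply hY)).sub
    ((hθt.mul hLY.norm_sq).const_mul (K / 2))).congr_fderiv ?_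
  ext v
  simp only [_root_.add_apply, _root_.sub_apply,
    _root_.smul_apply, ContinuousLinearMap.comp_apply, smul_eq_mul, map_sub, map_smul,
    ContinuousLinearMap.flip_apply, ContinuousLinearMap.smulRight_apply, innerSL_apply_apply,
    ContinuousLinearMap.toSpanSingleton_apply, ContinuousLinearMap.id_apply, hPX]
  ring

set_option maxHeartbeats 1000000 in
/-- A second order Taylor expansion with a large coercive term. -/
theorem hamiltonian_add_sq_le {W : Type*} [NormedAddCommGroup W] [InnerProductSpace ℝ W]
    {L : E →L[ℝ] W} {m : ℝ} (hm : ∀ v, ‖v‖ ≤ m * ‖L v‖)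
    {H : E × (E →L[ℝ] ℝ) → ℝ} {z : E × (E →L[ℝ] ℝ)} {C Cμ c h K r : ℝ} {y v : E}
    {p' e : E →L[ℝ] ℝ} {μ : E →L[ℝ] ℝ} (hC : 0 ≤ C) (hc : 0 ≤ c)
    (hCμ : Cμ = (c + ‖L‖ ^ 2) * c + ‖L‖ ^ 2 * (1 + c * c))
    (hK : K = 2 * m ^ 2 * (C * (1 + Cμ) ^ 2 + 1))
    (hv : ‖v‖ ≤ c) (hp : ‖p'‖ ≤ c) (he : ‖e‖ ≤ c) (hev : e v = 1)
    (hKy : K * ‖y‖ ≤ 1) (hKr : K * |r| ≤ 1)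
    (hμ : μ = (p' y - K / 2 * ‖L y‖ ^ 2) • e - (K * r) • (innerSL ℝ (L y) ∘L L ∘L
            (ContinuousLinearMap.id ℝ E - e.smulRight v)))
    (hz : H z = h) (hD : fderiv ℝ H z (y, μ) = μ v - p' y)
    (hT : H (z + (y, μ)) ≤ H z + fderiv ℝ H z (y, μ) + C * ‖(y, μ)‖ ^ 2) :
    H (z + (y, μ)) + ‖y‖ ^ 2 ≤ h := by
  have hCμ0 : 0 ≤ Cμ := by rw [hCμ]; positivity
  have hK0 : 0 ≤ K := by rw [hK]; positivity
  have hLy : ‖L y‖ ≤ ‖L‖ * ‖y‖ := L.le_opNorm y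
  have hLy2 : ‖L y‖ ^ 2 ≤ ‖L‖ ^ 2 * ‖y‖ ^ 2 := by
    rw [← mul_pow]; exact pow_le_pow_left₀ (norm_nonneg _) hLy 2
  have h1 : |p' y - K / 2 * ‖L y‖ ^ 2| ≤ (c + ‖L‖ ^ 2) * ‖y‖ := by
    have h2 : |p' y| ≤ c * ‖y‖ := (p'.le_opNorm y).trans (by gcongr)
    have h3 : K / 2 * ‖L y‖ ^ 2 ≤ ‖L‖ ^ 2 * ‖y‖ := by
      calc K / 2 * ‖L y‖ ^ 2 ≤ K / 2 * (‖L‖ ^ 2 * ‖y‖ ^ 2) := by gcongr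
        _ = (K * ‖y‖) * (‖L‖ ^ 2 * ‖y‖) / 2 := by ring
        _ ≤ 1 * (‖L‖ ^ 2 * ‖y‖) / 2 := by gcongr
        _ ≤ ‖L‖ ^ 2 * ‖y‖ := by nlinarith [mul_nonneg (sq_nonneg ‖L‖) (norm_nonneg y)]
    have h4 : 0 ≤ K / 2 * ‖L y‖ ^ 2 := by positivity
    calc |p' y - K / 2 * ‖L y‖ ^ 2| ≤ |p' y| + |K / 2 * ‖L y‖ ^ 2| := abs_sub _ _
      _ ≤ c * ‖y‖ + ‖L‖ ^ 2 * ‖y‖ := by rw [abs_of_nonneg h4]; gcongr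
      _ = _ := by ring
  have h2 : ‖innerSL ℝ (L y) ∘L L ∘L (ContinuousLinearMap.id ℝ E - e.smulRight v)‖
      ≤ ‖L‖ ^ 2 * (1 + c * c) * ‖y‖ := by
    have h3 : ‖ContinuousLinearMap.id ℝ E - e.smulRight v‖ ≤ 1 + c * c := by
      refine (norm_sub_le _ _).trans (add_le_add ContinuousLinearMap.norm_id_le ?_)
      rw [ContinuousLinearMap.norm_smulRight_apply]
      gcongr
    calc _ ≤ ‖innerSL ℝ (L y)‖ * (‖L‖ * ‖ContinuousLinearMap.id ℝ E - e.smulRight v‖) :=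
          (ContinuousLinearMap.opNorm_comp_le _ _).trans
            (mul_le_mul_of_nonneg_left (ContinuousLinearMap.opNorm_comp_le _ _) (norm_nonneg _))
      _ ≤ (‖L‖ * ‖y‖) * (‖L‖ * (1 + c * c)) := by
          rw [innerSL_apply_norm]; gcongr
      _ = _ := by ring
  -- The bound must not depend on `K`, which is chosen after `Cμ`; the smallness conditions `hKy`
  -- and `hKr` absorb every factor `K`.
  have hμn : ‖μ‖ ≤ Cμ * ‖y‖ := by
    rw [hμ]
    calc _ ≤ |p' y - K / 2 * ‖L y‖ ^ 2| * ‖e‖ + |K * r| * ‖innerSL ℝ (L y) ∘L L ∘L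
            (ContinuousLinearMap.id ℝ E - e.smulRight v)‖ := by
          refine (norm_sub_le _ _).trans ?_
          rw [norm_smul, norm_smul, Real.norm_eq_abs, Real.norm_eq_abs]
      _ ≤ ((c + ‖L‖ ^ 2) * ‖y‖) * c + 1 * (‖L‖ ^ 2 * (1 + c * c) * ‖y‖) := by
          have : |K * r| ≤ 1 := by rwa [abs_mul, abs_of_nonneg hK0]
          gcongr
      _ = Cμ * ‖y‖ := by rw [hCμ]; ring
  -- `id - e ⊗ v` kills `v`, so the first order term `μ v - p' y` of `H` is exactly `-(K/2)‖L y‖²`.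
  have hμv : μ v = p' y - K / 2 * ‖L y‖ ^ 2 := by
    simp [hμ, hev]
  have hn : ‖((y, μ) : E × (E →L[ℝ] ℝ))‖ ≤ (1 + Cμ) * ‖y‖ := by
    rw [Prod.norm_mk]
    refine max_le ?_ (hμn.trans ?_) <;> nlinarith [norm_nonneg y, mul_nonneg hCμ0 (norm_nonneg y)]
  have hn2 : C * ‖((y, μ) : E × (E →L[ℝ] ℝ))‖ ^ 2 ≤ C * ((1 + Cμ) * ‖y‖) ^ 2 := by gcongr
  have hy2 : ‖y‖ ^ 2 ≤ m ^ 2 * ‖L y‖ ^ 2 := by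
    rw [← mul_pow]; exact pow_le_pow_left₀ (norm_nonneg _) (hm y) 2
  -- In `K`, the summand `C * (1 + Cμ) ^ 2` pays for the Taylor error and the extra `1` leaves the
  -- gain `‖y‖²`.
  have hKe : K / 2 * ‖L y‖ ^ 2 = (C * (1 + Cμ) ^ 2 + 1) * (m ^ 2 * ‖L y‖ ^ 2) := by
    rw [hK]; ring
  have h5 : (C * (1 + Cμ) ^ 2 + 1) * ‖y‖ ^ 2 ≤ (C * (1 + Cμ) ^ 2 + 1) * (m ^ 2 * ‖L y‖ ^ 2) := by
    gcongr
  rw [hD, hμv, hz, hKe] at hT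
  nlinarith

/-- The time function is constant on the hyperplanes of a linear form `τ` transverse to the curve:
`θ x` is the time at which the curve crosses the hyperplane through `x`. The quadratic penalty
carries the factor `θ - t`, so it is small near `X t` while its time derivative is not. -/
theorem exists_calibration [FiniteDimensional ℝ E] {H : E × (E →L[ℝ] ℝ) → ℝ} {X X' : ℝ → E}
    {P P' : ℝ → E →L[ℝ] ℝ} {t h : ℝ} (hH : ContDiffAt ℝ 2 H (X t, P t))
    (hX : ∀ᶠ s in 𝓝 t, HasDerivAt X (X' s) s) (hP : ∀ᶠ s in 𝓝 t, HasDerivAt P (P' s) s)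
    (hX' : ContinuousAt X' t) (hP' : ContinuousAt P' t) (hX0 : X' t ≠ 0)
    (hDH : ∀ᶠ s in 𝓝 t, ∀ y μ, fderiv ℝ H (X s, P s) (y, μ) = μ (X' s) - P' s y)
    (hh : ∀ᶠ s in 𝓝 t, H (X s, P s) = h) (hPX : ∀ᶠ s in 𝓝 t, P s (X' s) = 2 * h) :
    ∃ (θ f : E → ℝ) (F : E → E →L[ℝ] ℝ), θ (X t) = t ∧ F (X t) = P t ∧
      ContinuousAt F (X t) ∧
      (∀ᶠ x in 𝓝 (X t), HasFDerivAt f (F x) x ∧ ContinuousAt θ x ∧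
        H (x, F x) + ‖x - X (θ x)‖ ^ 2 ≤ h) ∧
      ∀ᶠ s in 𝓝 t, θ (X s) = s ∧ f (X s) = 2 * h * (s - t) := by
  obtain ⟨τ, hτ⟩ := SeparatingDual.exists_ne_zero (R := ℝ) hX0
  obtain ⟨ϑ, hϑt, hϑu, hϑ⟩ := exists_local_inverse_of_hasDerivAt (u := fun s => τ (X s))
    (u' := fun s => τ (X' s)) (t := t)
    (hX.mono fun s hs => τ.hasFDerivAt.comp_hasDerivAt s hs)
    (τ.continuous.continuousAt.comp hX') hτ
  -- The norm of `E` need not be differentiable; the penalty uses a Euclidean norm instead, and `m`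
  -- compares the two.
  set L : E →L[ℝ] EuclideanSpace ℝ (Fin (Module.finrank ℝ E)) :=
    (toEuclidean : E ≃L[ℝ] _).toContinuousLinearMap with hL
  obtain ⟨m, hm⟩ : ∃ m : ℝ, ∀ v, ‖v‖ ≤ m * ‖L v‖ := by
    refine ⟨‖(toEuclidean (E := E)).symm.toContinuousLinearMap‖, fun v => ?_⟩
    simpa [hL] using (toEuclidean (E := E)).symm.toContinuousLinearMap.le_opNorm (toEuclidean v)
  obtain ⟨C, hC, ρ, hρ, hT⟩ := hH.exists_ball_le_taylor
  have hXt := hX.self_of_nhds.continuousAt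
  have hPt := hP.self_of_nhds.continuousAt
  have hϑc : ContinuousAt ϑ (τ (X t)) := hϑ.self_of_nhds.continuousAt
  have hτx : Tendsto τ (𝓝 (X t)) (𝓝 (τ (X t))) := τ.continuous.continuousAt
  have hθt : ϑ (τ (X t)) = t := hϑt
  have hθ : Tendsto (fun x => ϑ (τ x)) (𝓝 (X t)) (𝓝 t) := by
    have := hϑc.tendsto.comp hτx
    rwa [hθt] at this
  have hY : Tendsto (fun x => x - X (ϑ (τ x))) (𝓝 (X t)) (𝓝 0) := by
    simpa using tendsto_id.sub (hXt.tendsto.comp hθ)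
  have hτX' : ContinuousAt (fun s => (τ (X' s))⁻¹ • τ) t :=
    ((τ.continuous.continuousAt.comp hX').inv₀ hτ).smul continuousAt_const
  obtain ⟨c, hc, hcX, hcP, hce⟩ : ∃ c : ℝ, 0 ≤ c ∧ ‖X' t‖ < c ∧ ‖P' t‖ < c ∧
      ‖(τ (X' t))⁻¹ • τ‖ < c := by
    refine ⟨‖X' t‖ + ‖P' t‖ + ‖(τ (X' t))⁻¹ • τ‖ + 1, by positivity, ?_, ?_, ?_⟩ <;>
    linarith [norm_nonneg (X' t), norm_nonneg (P' t), norm_nonneg ((τ (X' t))⁻¹ • τ)]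
  obtain ⟨Cμ, hCμ⟩ : ∃ Cμ : ℝ, Cμ = (c + ‖L‖ ^ 2) * c + ‖L‖ ^ 2 * (1 + c * c) := ⟨_, rfl⟩
  obtain ⟨K, hK⟩ : ∃ K : ℝ, K = 2 * m ^ 2 * (C * (1 + Cμ) ^ 2 + 1) := ⟨_, rfl⟩
  set M : E → E →L[ℝ] ℝ := fun x =>
    ((P' (ϑ (τ x)) (x - X (ϑ (τ x))) - K / 2 * ‖L (x - X (ϑ (τ x)))‖ ^ 2) •
            ((τ (X' (ϑ (τ x))))⁻¹ • τ)
          - (K * (ϑ (τ x) - t)) • (innerSL ℝ (L (x - X (ϑ (τ x)))) ∘L L ∘L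
            (ContinuousLinearMap.id ℝ E -
              ((τ (X' (ϑ (τ x))))⁻¹ • τ).smulRight (X' (ϑ (τ x)))))) with hM
  have hMXt : M (X t) = 0 := by simp [hM, hθt]
  -- `X'` and `P'` are continuous at `t` only, so continuity of `M` is available at the single point
  -- `X t`; this suffices to bring `(x, P + M)` into the Taylor ball.
  have hMt : Tendsto M (𝓝 (X t)) (𝓝 0) := by
    have e0 : ContinuousAt (fun x => ϑ (τ x)) (X t) := by rwa [ContinuousAt, hθt]
    have e1 : ContinuousAt (fun x => X' (ϑ (τ x))) (X t) := hX'.comp_of_eq e0 hθt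
    have e2 : ContinuousAt (fun x => P' (ϑ (τ x))) (X t) := hP'.comp_of_eq e0 hθt
    have e3 : ContinuousAt (fun x => (τ (X' (ϑ (τ x))))⁻¹ • τ) (X t) := hτX'.comp_of_eq e0 hθt
    have e4 : ContinuousAt (fun x => x - X (ϑ (τ x))) (X t) :=
      continuousAt_id.sub (hXt.comp_of_eq e0 hθt)
    have e5 : ContinuousAt (fun x => L (x - X (ϑ (τ x)))) (X t) :=
      L.continuous.continuousAt.comp e4
    have e6 : ContinuousAt (fun x => innerSL ℝ (L (x - X (ϑ (τ x))))) (X t) :=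
      (innerSL ℝ (E := EuclideanSpace ℝ (Fin (Module.finrank ℝ E)))).continuous.continuousAt.comp e5
    have e7 : ContinuousAt (fun x => ((τ (X' (ϑ (τ x))))⁻¹ • τ).smulRight (X' (ϑ (τ x)))) (X t) :=
      ((ContinuousLinearMap.smulRightL ℝ E E).continuous.continuousAt.comp e3).clm_apply e1
    have : ContinuousAt M (X t) :=
      (((e2.clm_apply e4).sub ((e5.norm.pow 2).const_mul (K / 2))).smul e3).sub
        (((e0.sub continuousAt_const).const_mul K).smul
          (e6.clm_comp (continuousAt_const.clm_comp (continuousAt_const.sub e7))))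
    rwa [ContinuousAt, hMXt] at this
  have hF : Tendsto (fun x => P (ϑ (τ x)) + M x) (𝓝 (X t)) (𝓝 (P t)) := by
    simpa using (hPt.tendsto.comp hθ).add hMt
  refine ⟨fun x => ϑ (τ x), fun x => 2 * h * (ϑ (τ x) - t) + P (ϑ (τ x)) (x - X (ϑ (τ x)))
        - K / 2 * ((ϑ (τ x) - t) * ‖L (x - X (ϑ (τ x)))‖ ^ 2),
      fun x => P (ϑ (τ x)) + M x, hθt, by simp [hMXt, hθt], ?_, ?_, ?_⟩
  · simpa [ContinuousAt, hMXt, hθt] using hF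
  · have hz1 : Tendsto (fun x => (X (ϑ (τ x)), P (ϑ (τ x)))) (𝓝 (X t)) (𝓝 (X t, P t)) :=
      (hXt.tendsto.comp hθ).prodMk_nhds (hPt.tendsto.comp hθ)
    have hz2 : Tendsto (fun x => (x, P (ϑ (τ x)) + M x)) (𝓝 (X t)) (𝓝 (X t, P t)) :=
      tendsto_id.prodMk_nhds hF
    have hKy : ∀ᶠ x in 𝓝 (X t), K * ‖x - X (ϑ (τ x))‖ < 1 := by
      have := hY.norm.const_mul K
      rw [norm_zero, mul_zero] at this
      exact this.eventually (gt_mem_nhds one_pos)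
    have hKr : ∀ᶠ x in 𝓝 (X t), K * |ϑ (τ x) - t| < 1 := by
      have := (hθ.sub_const t).abs.const_mul K
      rw [sub_self, abs_zero, mul_zero] at this
      exact this.eventually (gt_mem_nhds one_pos)
    filter_upwards [hz1.eventually (Metric.ball_mem_nhds _ hρ),
      hz2.eventually (Metric.ball_mem_nhds _ hρ), hKy, hKr,
      hθ.eventually (hX'.norm.eventually (gt_mem_nhds hcX)),
      hθ.eventually (hP'.norm.eventually (gt_mem_nhds hcP)),
      hθ.eventually (hτX'.norm.eventually (gt_mem_nhds hce)),
      hθ.eventually hX, hθ.eventually hP, hθ.eventually hDH, hθ.eventually hh,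
      hθ.eventually hPX, hτx.eventually hϑ,
      hθ.eventually ((τ.continuous.continuousAt.comp hX').eventually_ne hτ)]
      with x b1 b2 b3 b4 b5 b6 b7 b8 b9 b10 b11 b12 b13 b14
    refine ⟨hasFDerivAt_calibration L τ b13 b8 b9 b12,
      b13.continuousAt.comp (f := τ) τ.continuous.continuousAt, ?_⟩
    have hadd : ((X (ϑ (τ x)), P (ϑ (τ x))) : E × (E →L[ℝ] ℝ)) + (x - X (ϑ (τ x)), M x)
        = (x, P (ϑ (τ x)) + M x) := by simp
    have := hamiltonian_add_sq_le hm (H := H) (z := (X (ϑ (τ x)), P (ϑ (τ x))))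
      (y := x - X (ϑ (τ x))) (μ := M x) (r := ϑ (τ x) - t) hC hc hCμ hK b5.le b6.le b7.le
      (by simpa using inv_mul_cancel₀ b14) b3.le b4.le rfl b11 (b10 _ _) (by
        have := hT _ b1 _ b2
        rwa [← hadd, add_sub_cancel_left] at this)
    rwa [hadd] at this
  · filter_upwards [hϑu] with s hs
    simp [hs]

end Calibration

/-! ### Lorentzian linear algebra -/

namespace LinearMap.BilinForm

variable {V : Type*} [AddCommGroup V] [Module ℝ V] [FiniteDimensional ℝ V]
  {B : LinearMap.BilinForm ℝ V}

/-- Otherwise `u` and `w` would span a negative definite plane, against index one. -/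
theorem nonneg_of_sigNeg_eq_one (hs : B.IsSymm)
    (h1 : sigNeg (LinearMap.BilinMap.toQuadraticMap B) = 1)
    {u w : V} (hu : B u u < 0) (huw : B w u = 0) : 0 ≤ B w w := by
  by_contra! hw
  have huw' : B u w = 0 := by rw [hs.eq w u |>.symm] at *; simpa using huw
  have hli : LinearIndependent ℝ ![u, w] := by
    rw [LinearIndependent.pair_iff]
    intro a b hab
    have e1 := congrArg (B u) hab
    have e2 := congrArg (B w) hab
    simp only [map_add, map_smul, smul_eq_mul, huw, huw', map_zero, mul_zero, add_zero,
      zero_add, mul_eq_zero] at e1 e2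
    exact ⟨e1.resolve_right hu.ne, e2.resolve_right hw.ne⟩
  have h2 := le_sigNeg_of_negDef (Q := LinearMap.BilinMap.toQuadraticMap B)
    (V := Submodule.span ℝ (Set.range ![u, w])) (by
      rintro ⟨x, hx⟩ hx0
      rw [Matrix.range_cons, Matrix.range_cons, Matrix.range_empty, union_empty,
        singleton_union, Submodule.mem_span_pair] at hx
      obtain ⟨a, b, rfl⟩ := hx
      have hab : ¬ (a = 0 ∧ b = 0) := by
        rintro ⟨rfl, rfl⟩
        exact hx0 (by simp)
      simp only [QuadraticMap.restrict_apply, _root_.neg_apply,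
        LinearMap.BilinMap.toQuadraticMap_apply, map_add, map_smul, LinearMap.add_apply,
        LinearMap.smul_apply, smul_eq_mul, huw, huw']
      rcases not_and_or.mp hab with h | h
      · nlinarith [mul_pos (sq_pos_of_ne_zero h) (neg_pos.mpr hu), mul_nonneg (sq_nonneg b) (neg_pos.mpr hw).le]
      · nlinarith [mul_pos (sq_pos_of_ne_zero h) (neg_pos.mpr hw), mul_nonneg (sq_nonneg a) (neg_pos.mpr hu).le])
  rw [h1, finrank_span_eq_card hli] at h2
  simp at h2

theorem mul_le_sq_of_sigNeg_eq_one (hs : B.IsSymm)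
    (h1 : sigNeg (LinearMap.BilinMap.toQuadraticMap B) = 1)
    {u : V} (hu : B u u < 0) (v : V) : B u u * B v v ≤ B u v ^ 2 := by
  have hsym : B v u = B u v := by simpa using (hs.eq u v).symm
  -- The component of `v` orthogonal to `u`.
  have h := nonneg_of_sigNeg_eq_one hs h1 (u := u) (w := v - (B u v / B u u) • u) hu (by
    simp [hsym, hu.ne])
  simp only [map_sub, map_smul, LinearMap.sub_apply, LinearMap.smul_apply, smul_eq_mul, hsym,
    div_mul_cancel₀ _ hu.ne] at h
  have h' := mul_nonneg_of_nonpos_of_nonpos hu.le (neg_nonpos.mpr h)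
  have : B u u * (B u v / B u u * B u v) = B u v ^ 2 := by
    rw [← mul_assoc, mul_div_cancel₀ _ hu.ne, sq]
  nlinarith

theorem neg_of_mem_timecone (hs : B.IsSymm)
    (h1 : sigNeg (LinearMap.BilinMap.toQuadraticMap B) = 1)
    {u v X : V} (hX : B X X < 0) (hu : B u u < 0) (hv : B v v ≤ 0) (huX : B u X < 0)
    (hvX : B v X < 0) : B u v < 0 := by
  by_contra! huv
  have hsym : B v u = B u v := by simpa using (hs.eq u v).symm
  -- This combination is orthogonal to `X`. If `B u v ≥ 0`, the signs of its coefficients make its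
  -- square negative.
  have h := nonneg_of_sigNeg_eq_one hs h1 (u := X) (w := (B v X) • u - (B u X) • v) hX (by
    simp [mul_comm])
  simp only [map_sub, map_smul, LinearMap.sub_apply, LinearMap.smul_apply, smul_eq_mul, hsym] at h
  nlinarith [mul_pos (mul_pos_of_neg_of_neg hvX hvX) (neg_pos.mpr hu),
    mul_nonneg (mul_pos_of_neg_of_neg huX huX).le (neg_nonneg.mpr hv),
    mul_nonneg (mul_pos_of_neg_of_neg huX hvX).le huv]

/-- The reverse Cauchy-Schwarz inequality for two vectors in the same time cone. -/
theorem apply_le_neg_sqrt_mul_sqrt (hs : B.IsSymm)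
    (h1 : sigNeg (LinearMap.BilinMap.toQuadraticMap B) = 1)
    {u v X : V} (hX : B X X < 0) (hu : B u u < 0) (hv : B v v ≤ 0) (huX : B u X < 0)
    (hvX : B v X < 0) : B u v ≤ -(√|B u u| * √|B v v|) := by
  have h2 := neg_of_mem_timecone hs h1 hX hu hv huX hvX
  have h3 := mul_le_sq_of_sigNeg_eq_one hs h1 hu v
  rw [← Real.sqrt_mul (abs_nonneg _), ← abs_mul, abs_of_nonneg
    (mul_nonneg_of_nonpos_of_nonpos hu.le hv)]
  have h4 := Real.sqrt_le_sqrt h3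
  rw [Real.sqrt_sq_eq_abs, abs_of_neg h2] at h4
  linarith

end LinearMap.BilinForm

/-! ### Smoothness of the Hamiltonian in a chart -/

section MatrixInverse

variable {G : Type*} [NormedAddCommGroup G] [NormedSpace ℝ G] {ι : Type*} [Fintype ι]
  [DecidableEq ι] {A : G → Matrix ι ι ℝ} {x : G} {n : WithTop ℕ∞}

theorem ContDiffAt.matrix_det (hA : ∀ i j, ContDiffAt ℝ n (fun y => A y i j) x) :
    ContDiffAt ℝ n (fun y => (A y).det) x := by
  simp only [Matrix.det_apply]
  refine ContDiffAt.sum fun σ _ => ContDiffAt.const_smul _ ?_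
  exact contDiffAt_prod fun i _ => hA _ _

theorem ContDiffAt.matrix_inv (hA : ∀ i j, ContDiffAt ℝ n (fun y => A y i j) x)
    (h0 : (A x).det ≠ 0) (i j : ι) : ContDiffAt ℝ n (fun y => (A y)⁻¹ i j) x := by
  simp only [Matrix.inv_def, Ring.inverse_eq_inv', Matrix.smul_apply, smul_eq_mul,
    Matrix.adjugate_apply]
  refine ((ContDiffAt.matrix_det hA).inv h0).mul (ContDiffAt.matrix_det fun k l => ?_)
  rcases eq_or_ne k j with rfl | hk
  · simpa using contDiffAt_const
  · simpa [Matrix.updateRow_ne hk] using hA k l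

end MatrixInverse

section ChartVectorField

variable {E : Type*} [NormedAddCommGroup E] [NormedSpace ℝ E]
    {M : Type*} [TopologicalSpace M] [ChartedSpace E M] [IsManifold 𝓘(ℝ, E) ∞ M]

variable (E) in
/-- The derivative at `p` of the chart at `x₀`, with values in the model space. -/
noncomputable def tangentChart (x₀ p : M) : TangentSpace 𝓘(ℝ, E) p →L[ℝ] E :=
  mfderiv 𝓘(ℝ, E) 𝓘(ℝ, E) (extChartAt 𝓘(ℝ, E) x₀) p

/-- The expression in the chart at `x₀` of a vector field on `M`. -/
noncomputable def vectorFieldInChart (x₀ : M) (Z : ∀ p : M, TangentSpace 𝓘(ℝ, E) p) (x : E) : E :=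
  tangentChart E x₀ ((extChartAt 𝓘(ℝ, E) x₀).symm x)
    (Z ((extChartAt 𝓘(ℝ, E) x₀).symm x))

theorem trivializationAt_snd_eq_tangentChart (x₀ : M) (Z : ∀ p : M, TangentSpace 𝓘(ℝ, E) p) {p : M}
    (hp : p ∈ (chartAt E x₀).source) :
    (trivializationAt E (TangentSpace 𝓘(ℝ, E)) x₀
        (⟨p, Z p⟩ : TangentBundle 𝓘(ℝ, E) M)).2 =
      tangentChart E x₀ p (Z p) := by
  have : IsManifold 𝓘(ℝ, E) 1 M := IsManifold.of_le (n := ∞) (by norm_num)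
  rw [tangentChart, ← TangentBundle.continuousLinearMapAt_trivializationAt hp]
  exact (congrFun ((trivializationAt E (TangentSpace 𝓘(ℝ, E)) x₀).coe_linearMapAt_of_mem (R := ℝ)
    (by simpa using hp)) (Z p)).symm

theorem contDiffAt_vectorFieldInChart {x₀ p : M} (hp : p ∈ (chartAt E x₀).source)
    {Z : ∀ p : M, TangentSpace 𝓘(ℝ, E) p}
    (hZ : ContMDiffAt 𝓘(ℝ, E) 𝓘(ℝ, E).tangent ∞
      (fun p => (⟨p, Z p⟩ : TangentBundle 𝓘(ℝ, E) M)) p) :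
    ContDiffAt ℝ ∞ (vectorFieldInChart x₀ Z) (extChartAt 𝓘(ℝ, E) x₀ p) := by
  have h1 : ContMDiffAt 𝓘(ℝ, E) 𝓘(ℝ, E) ∞ (fun p => (trivializationAt E
      (TangentSpace 𝓘(ℝ, E)) x₀ (⟨p, Z p⟩ : TangentBundle 𝓘(ℝ, E) M)).2) p :=
    ((trivializationAt E (TangentSpace 𝓘(ℝ, E)) x₀).contMDiffAt_section_iff
      (by simpa using hp)).mp hZ
  have h2 : ContMDiffAt 𝓘(ℝ, E) 𝓘(ℝ, E) ∞ (extChartAt 𝓘(ℝ, E) x₀).symm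
      (extChartAt 𝓘(ℝ, E) x₀ p) :=
    (contMDiffOn_extChartAt_symm x₀).contMDiffAt
      ((isOpen_extChartAt_target x₀).mem_nhds (by simpa using (chartAt E x₀).map_source hp))
  have hl : (extChartAt 𝓘(ℝ, E) x₀).symm (extChartAt 𝓘(ℝ, E) x₀ p) = p :=
    (extChartAt 𝓘(ℝ, E) x₀).left_inv (by simpa using hp)
  have h3 := ContMDiffAt.comp_of_eq h1 h2 hl
  rw [contMDiffAt_iff_contDiffAt] at h3
  refine h3.congr_of_eventuallyEq ?_
  filter_upwards [(isOpen_extChartAt_target (I := 𝓘(ℝ, E)) x₀).mem_nhds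
    ((extChartAt 𝓘(ℝ, E) x₀).map_source (by simpa using hp))] with x hx
  exact (trivializationAt_snd_eq_tangentChart x₀ Z
    (by simpa using (extChartAt 𝓘(ℝ, E) x₀).map_target hx)).symm

theorem continuousAt_vectorFieldInChart {x₀ p : M} (hp : p ∈ (chartAt E x₀).source)
    {Z : ∀ p : M, TangentSpace 𝓘(ℝ, E) p}
    (hZ : ContinuousAt (fun p => (⟨p, Z p⟩ : TangentBundle 𝓘(ℝ, E) M)) p) :
    ContinuousAt (vectorFieldInChart x₀ Z) (extChartAt 𝓘(ℝ, E) x₀ p) := by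
  have h1 : ContinuousAt (fun p => (trivializationAt E
      (TangentSpace 𝓘(ℝ, E)) x₀ (⟨p, Z p⟩ : TangentBundle 𝓘(ℝ, E) M)).2) p := by
    refine continuousAt_snd.comp (((trivializationAt E (TangentSpace 𝓘(ℝ, E))
      x₀).continuousAt ?_).comp hZ)
    rw [Bundle.Trivialization.mem_source]
    simpa using hp
  have h2 : ContinuousAt (extChartAt 𝓘(ℝ, E) x₀).symm (extChartAt 𝓘(ℝ, E) x₀ p) :=
    continuousAt_extChartAt_symm' (by simpa using hp)
  have hl : (extChartAt 𝓘(ℝ, E) x₀).symm (extChartAt 𝓘(ℝ, E) x₀ p) = p :=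
    (extChartAt 𝓘(ℝ, E) x₀).left_inv (by simpa using hp)
  refine (ContinuousAt.comp_of_eq h1 h2 hl).congr ?_
  filter_upwards [(isOpen_extChartAt_target (I := 𝓘(ℝ, E)) x₀).mem_nhds
    ((extChartAt 𝓘(ℝ, E) x₀).map_source (by simpa using hp))] with x hx
  exact trivializationAt_snd_eq_tangentChart x₀ Z
    (by simpa using (extChartAt 𝓘(ℝ, E) x₀).map_target hx)

end ChartVectorField

namespace SubLorentzianStructure

variable {E : Type*} [NormedAddCommGroup E] [NormedSpace ℝ E]
    [FiniteDimensional ℝ E] {M : Type*} [TopologicalSpace M]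
  [ChartedSpace E M] [IsManifold 𝓘(ℝ, E) ∞ M] (S : SubLorentzianStructure E M)

theorem sharp_add (p : M) (ξ ζ : CotangentSpaceAt E p) :
    S.sharp p (ξ + ζ) = S.sharp p ξ + S.sharp p ζ := by
  rw [sharp, sharp, sharp, ← map_add]; rfl

theorem sharp_smul (p : M) (c : ℝ) (ξ : CotangentSpaceAt E p) :
    S.sharp p (c • ξ) = c • S.sharp p ξ := by
  rw [sharp, sharp, ← map_smul]; rfl

/-- The expression of `ξ ↦ ξ^♯` in the canonical coordinates induced by the chart at `x₀`. -/
noncomputable def chartSharp (x₀ : M) (x : E) : (E →L[ℝ] ℝ) →ₗ[ℝ] E where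
  toFun ξ := tangentChart E x₀ ((extChartAt 𝓘(ℝ, E) x₀).symm x)
    (S.sharp ((extChartAt 𝓘(ℝ, E) x₀).symm x)
      (ξ ∘L tangentChart E x₀ ((extChartAt 𝓘(ℝ, E) x₀).symm x)))
  map_add' ξ ζ := by
    rw [ContinuousLinearMap.add_comp, sharp_add, Submodule.coe_add, map_add]
  map_smul' c ξ := by
    rw [ContinuousLinearMap.smul_comp, sharp_smul, Submodule.coe_smul, map_smul, RingHom.id_apply]

theorem apply_chartSharp (x₀ : M) (x : E) (ξ ζ : E →L[ℝ] ℝ) :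
    ξ (S.chartSharp x₀ x ζ) = S.g ((extChartAt 𝓘(ℝ, E) x₀).symm x)
      (S.sharp _ (ξ ∘L tangentChart E x₀ ((extChartAt 𝓘(ℝ, E) x₀).symm x)))
      (S.sharp _ (ζ ∘L tangentChart E x₀ ((extChartAt 𝓘(ℝ, E) x₀).symm x))) := by
  rw [g_sharp]; rfl

theorem chartSharp_symm (x₀ : M) (x : E) (ξ ζ : E →L[ℝ] ℝ) :
    ξ (S.chartSharp x₀ x ζ) = ζ (S.chartSharp x₀ x ξ) := by
  rw [apply_chartSharp, apply_chartSharp]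
  exact (S.symm _).eq _ _

theorem chartHamiltonian_eq (x₀ : M) (x : E) (ξ : E →L[ℝ] ℝ) :
    S.chartHamiltonian x₀ x ξ = 1 / 2 * ξ (S.chartSharp x₀ x ξ) := by
  rw [apply_chartSharp]; rfl

/-- `H` is half the quadratic form of a symmetric map, continuous because the dimension is finite.
Thus the equation `x' = ∂H/∂ξ` reads `x' = ξ^♯`. -/
theorem fderiv_chartHamiltonian_covector (x₀ : M) (x : E) (ξ ζ : E →L[ℝ] ℝ) :
    fderiv ℝ (fun ξ => S.chartHamiltonian x₀ x ξ) ξ ζ = ζ (S.chartSharp x₀ x ξ) := by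
  let Λ := (S.chartSharp x₀ x).toContinuousLinearMap
  have hΛ : ∀ ξ, Λ ξ = S.chartSharp x₀ x ξ := fun ξ => rfl
  have h1 : (fun ξ => S.chartHamiltonian x₀ x ξ) = fun ξ => 1 / 2 * ξ (Λ ξ) := by
    funext ξ; rw [chartHamiltonian_eq, hΛ]
  have h2 : HasFDerivAt (fun ξ : E →L[ℝ] ℝ => 1 / 2 * ξ (Λ ξ)) _ ξ :=
    ((hasFDerivAt_id ξ).clm_apply Λ.hasFDerivAt).const_mul (1 / 2)
  rw [h1, h2.fderiv]
  simp only [_root_.add_apply, _root_.smul_apply, ContinuousLinearMap.comp_apply, smul_eq_mul,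
    ContinuousLinearMap.flip_apply, ContinuousLinearMap.id_apply, id, hΛ,
    S.chartSharp_symm x₀ x ξ ζ]
  ring

/-- The coordinate expression of `ξ^♯` in a local frame. -/
theorem sharp_eq_sum {ι : Type*} [Fintype ι] [DecidableEq ι] {p : M} {Y : ι → S.D p}
    (hli : LinearIndependent ℝ Y) (hsp : Submodule.span ℝ (Set.range Y) = ⊤)
    (ξ : CotangentSpaceAt E p) :
    (Matrix.of fun i j => S.g p (Y i) (Y j)).det ≠ 0 ∧
    S.sharp p ξ = ∑ j, (∑ i, (Matrix.of fun i j => S.g p (Y i) (Y j))⁻¹ i j *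
      ξ (Y i : TangentSpace 𝓘(ℝ, E) p)) • Y j := by
  let b := Module.Basis.mk hli hsp.ge
  have hb : ∀ i, b i = Y i := fun i => Module.Basis.mk_apply hli hsp.ge i
  set A : Matrix ι ι ℝ := Matrix.of fun i j => S.g p (Y i) (Y j) with hA
  have hdet : A.det ≠ 0 := by
    have h1 := (LinearMap.BilinForm.nondegenerate_iff_det_ne_zero b).mp (S.nondegenerate p)
    have h2 : LinearMap.BilinForm.toMatrix b (S.g p) = A := by
      ext i j
      simp [hA, LinearMap.BilinForm.toMatrix_apply, hb]
    rwa [h2] at h1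
  refine ⟨hdet, ?_⟩
  have hsym : ∀ i j, A i j = A j i := fun i j => (S.symm p).eq _ _
  have h1 : ∀ i, ξ (Y i : TangentSpace 𝓘(ℝ, E) p) = ∑ k, b.repr (S.sharp p ξ) k * A k i := by
    intro i
    rw [← S.g_sharp p ξ (Y i)]
    conv_lhs => rw [← b.sum_repr (S.sharp p ξ)]
    simp [hA, hb]
  conv_lhs => rw [← b.sum_repr (S.sharp p ξ)]
  refine Finset.sum_congr rfl fun j _ => ?_
  rw [hb]
  congr 1
  have h2 : ∀ k, ∑ i, A k i * A⁻¹ i j = if k = j then 1 else 0 := fun k => by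
    rw [← Matrix.mul_apply, Matrix.mul_nonsing_inv _ (isUnit_iff_ne_zero.mpr hdet),
      Matrix.one_apply]
  calc b.repr (S.sharp p ξ) j = ∑ k, b.repr (S.sharp p ξ) k * ∑ i, A k i * A⁻¹ i j := by
        simp [h2]
    _ = _ := by
        simp only [h1, Finset.mul_sum]
        rw [Finset.sum_comm]
        exact Finset.sum_congr rfl fun i _ => Finset.sum_congr rfl fun k _ => by ring

/-- In a smooth frame `ξ^♯` is given by the inverse Gram matrix, which is smooth by Cramer's rule.
-/
theorem contDiffAt_chartSharp (x₀ : M) : ∀ᶠ x in 𝓝 (extChartAt 𝓘(ℝ, E) x₀ x₀), ∀ ξ : E →L[ℝ] ℝ,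
    ContDiffAt ℝ ∞ (fun z : E × (E →L[ℝ] ℝ) => S.chartSharp x₀ z.1 z.2) (x, ξ) := by
  obtain ⟨U, hU, hx₀, Y, hY, hYb, hYg⟩ := S.exists_smooth_frame x₀
  have hV : IsOpen ((extChartAt 𝓘(ℝ, E) x₀).target ∩ (extChartAt 𝓘(ℝ, E) x₀).symm ⁻¹' U) :=
    (continuousOn_extChartAt_symm x₀).isOpen_inter_preimage (isOpen_extChartAt_target x₀) hU
  have hV₀ : extChartAt 𝓘(ℝ, E) x₀ x₀ ∈
      (extChartAt 𝓘(ℝ, E) x₀).target ∩ (extChartAt 𝓘(ℝ, E) x₀).symm ⁻¹' U :=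
    ⟨mem_extChartAt_target x₀, by simpa using hx₀⟩
  filter_upwards [hV.mem_nhds hV₀] with x hx ξ
  have hYx : ∀ i, ContDiffAt ℝ ∞ (vectorFieldInChart x₀
      (fun p => (Y i p : TangentSpace 𝓘(ℝ, E) p))) x := fun i => by
    have := contDiffAt_vectorFieldInChart (x₀ := x₀) (p := (extChartAt 𝓘(ℝ, E) x₀).symm x)
      (by simpa using (extChartAt 𝓘(ℝ, E) x₀).map_target hx.1)
      ((hY i).contMDiffAt (hU.mem_nhds hx.2))
    rwa [(extChartAt 𝓘(ℝ, E) x₀).right_inv hx.1] at this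
  have hgx : ∀ i j, ContDiffAt ℝ ∞ (fun x => S.g ((extChartAt 𝓘(ℝ, E) x₀).symm x)
      (Y i _) (Y j _)) x := fun i j => by
    have := ((hYg i j).contMDiffAt (hU.mem_nhds hx.2)).comp x
      ((contMDiffOn_extChartAt_symm x₀).contMDiffAt
        ((isOpen_extChartAt_target x₀).mem_nhds hx.1))
    exact contMDiffAt_iff_contDiffAt.mp this
  have hfst : ContDiffAt ℝ ∞ (Prod.fst : E × (E →L[ℝ] ℝ) → E) (x, ξ) := contDiffAt_fst
  have hsnd : ContDiffAt ℝ ∞ (Prod.snd : E × (E →L[ℝ] ℝ) → (E →L[ℝ] ℝ)) (x, ξ) := contDiffAt_snd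
  have hYf : ∀ i, ContDiffAt ℝ ∞ (fun z : E × (E →L[ℝ] ℝ) => vectorFieldInChart x₀
      (fun p => (Y i p : TangentSpace 𝓘(ℝ, E) p)) z.1) (x, ξ) := fun i =>
    ContDiffAt.comp (g := vectorFieldInChart x₀ (fun p => (Y i p : TangentSpace 𝓘(ℝ, E) p)))
      (x, ξ) (hYx i) hfst
  have hdet := (S.sharp_eq_sum (hYb _ hx.2).1 (hYb _ hx.2).2 0).1
  have key : ContDiffAt ℝ ∞ (fun z : E × (E →L[ℝ] ℝ) => ∑ j, (∑ i,
      (Matrix.of fun i j => S.g ((extChartAt 𝓘(ℝ, E) x₀).symm z.1) (Y i _) (Y j _))⁻¹ i j *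
        z.2 (vectorFieldInChart x₀ (fun p => (Y i p : TangentSpace 𝓘(ℝ, E) p)) z.1)) •
        vectorFieldInChart x₀ (fun p => (Y j p : TangentSpace 𝓘(ℝ, E) p)) z.1) (x, ξ) := by
    refine ContDiffAt.sum fun j _ => ContDiffAt.smul (ContDiffAt.sum fun i _ => ?_) (hYf j)
    refine ContDiffAt.mul ?_ (hsnd.clm_apply (hYf i))
    exact (ContDiffAt.matrix_inv (A := fun x => Matrix.of fun i j =>
      S.g ((extChartAt 𝓘(ℝ, E) x₀).symm x) (Y i _) (Y j _)) hgx hdet i j).comp (x, ξ) hfst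
  refine key.congr_of_eventuallyEq ?_
  filter_upwards [continuousAt_fst.preimage_mem_nhds (hV.mem_nhds hx)] with z hz
  have := (S.sharp_eq_sum (hYb _ hz.2).1 (hYb _ hz.2).2
    (z.2 ∘L tangentChart E x₀ ((extChartAt 𝓘(ℝ, E) x₀).symm z.1))).2
  change tangentChart E x₀ ((extChartAt 𝓘(ℝ, E) x₀).symm z.1)
    (S.sharp ((extChartAt 𝓘(ℝ, E) x₀).symm z.1) (z.2 ∘L tangentChart E x₀
      ((extChartAt 𝓘(ℝ, E) x₀).symm z.1)) : S.D _) = _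
  rw [this]
  simp only [Submodule.coe_sum, Submodule.coe_smul, map_sum, map_smul]
  rfl

end SubLorentzianStructure

/-! ### Hamiltonian trajectories in a chart -/

/-- A solution of an autonomous equation on a closed interval extends, near each of its points, to
a solution on an open interval. -/
theorem exists_eventually_hasDerivAt_extend {G : Type*} [NormedAddCommGroup G] [NormedSpace ℝ G]
    [CompleteSpace G] {V : G → G} {z : ℝ → G} {a b t : ℝ} (hV : ContDiffAt ℝ 1 V (z t))
    (ht : t ∈ Icc a b)
    (hz : ∀ᶠ s in 𝓝[Icc a b] t, HasDerivWithinAt z (V (z s)) (Icc a b) s) :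
    ∃ w : ℝ → G, w t = z t ∧ (∀ᶠ s in 𝓝 t, HasDerivAt w (V (w s)) s) ∧
      ∀ᶠ s in 𝓝[Icc a b] t, w s = z s := by
  obtain ⟨w, hwt, ε, hε, hw⟩ :=
    hV.exists_forall_mem_closedBall_exists_eq_forall_mem_Ioo_hasDerivAt₀ t
  have hw' : ∀ᶠ s in 𝓝 t, HasDerivAt w (V (w s)) s :=
    eventually_of_mem (Ioo_mem_nhds (by linarith) (by linarith)) hw
  refine ⟨w, hwt, hw', ?_⟩
  obtain ⟨K, N, hN, hK⟩ := hV.exists_lipschitzOnWith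
  have hzN : ∀ᶠ s in 𝓝[Icc a b] t, z s ∈ N :=
    (hz.self_of_nhdsWithin ht).continuousWithinAt.eventually hN
  have hwN : ∀ᶠ s in 𝓝 t, w s ∈ N :=
    hw'.self_of_nhds.continuousAt.eventually (by rwa [hwt])
  have hall := (hz.and hzN).and ((hw'.and hwN).filter_mono nhdsWithin_le_nhds)
  rw [eventually_nhdsWithin_iff, Metric.eventually_nhds_iff] at hall ⊢
  obtain ⟨δ, hδ, H⟩ := hall
  refine ⟨δ, hδ, fun s hs hsI => ?_⟩
  rw [Real.dist_eq, abs_lt] at hs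
  -- Uniqueness is applied on each side of `t` separately, since `t` may be an endpoint of `[a, b]`.
  rcases le_total t s with hts | hst
  · have hH : ∀ r ∈ Icc t s, r ∈ Icc a b ∧ (HasDerivWithinAt z (V (z r)) (Icc a b) r ∧ z r ∈ N) ∧
        HasDerivAt w (V (w r)) r ∧ w r ∈ N := fun r hr => by
      have hr' : r ∈ Icc a b := ⟨ht.1.trans hr.1, hr.2.trans hsI.2⟩
      refine ⟨hr', H ?_ hr'⟩
      rw [Real.dist_eq, abs_lt]
      constructor <;> linarith [hr.1, hr.2]
    refine ODE_solution_unique_of_mem_Icc_right (v := fun _ => V) (s := fun _ => N) (a := t) (b := s)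
      (fun _ _ => hK)
      (fun r hr => (hH r hr).2.2.1.continuousAt.continuousWithinAt)
      (fun r hr => (hH r (Ico_subset_Icc_self hr)).2.2.1.hasDerivWithinAt)
      (fun r hr => (hH r (Ico_subset_Icc_self hr)).2.2.2)
      (fun r hr => (hH r hr).2.1.1.continuousWithinAt.mono
        (Icc_subset_Icc ht.1 hsI.2))
      (fun r hr => (hH r (Ico_subset_Icc_self hr)).2.1.1.mono_of_mem_nhdsWithin ?_)
      (fun r hr => (hH r (Ico_subset_Icc_self hr)).2.1.2) hwt (right_mem_Icc.mpr hts)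
    exact mem_of_superset (Icc_mem_nhdsGE (hr.2.trans_le hsI.2))
      (Icc_subset_Icc_left (ht.1.trans hr.1))
  · have hH : ∀ r ∈ Icc s t, r ∈ Icc a b ∧ (HasDerivWithinAt z (V (z r)) (Icc a b) r ∧ z r ∈ N) ∧
        HasDerivAt w (V (w r)) r ∧ w r ∈ N := fun r hr => by
      have hr' : r ∈ Icc a b := ⟨hsI.1.trans hr.1, hr.2.trans ht.2⟩
      refine ⟨hr', H ?_ hr'⟩
      rw [Real.dist_eq, abs_lt]
      constructor <;> linarith [hr.1, hr.2]
    refine ODE_solution_unique_of_mem_Icc_left (v := fun _ => V) (s := fun _ => N) (a := s) (b := t)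
      (fun _ _ => hK)
      (fun r hr => (hH r hr).2.2.1.continuousAt.continuousWithinAt)
      (fun r hr => (hH r (Ioc_subset_Icc_self hr)).2.2.1.hasDerivWithinAt)
      (fun r hr => (hH r (Ioc_subset_Icc_self hr)).2.2.2)
      (fun r hr => (hH r hr).2.1.1.continuousWithinAt.mono
        (Icc_subset_Icc hsI.1 ht.2))
      (fun r hr => (hH r (Ioc_subset_Icc_self hr)).2.1.1.mono_of_mem_nhdsWithin ?_)
      (fun r hr => (hH r (Ioc_subset_Icc_self hr)).2.1.2) hwt (left_mem_Icc.mpr hst)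
    exact mem_of_superset (Icc_mem_nhdsLE (hsI.1.trans_lt hr.1))
      (Icc_subset_Icc_right (hr.2.trans ht.2))

namespace SubLorentzianStructure

variable {E : Type*} [NormedAddCommGroup E] [NormedSpace ℝ E]
    [FiniteDimensional ℝ E] {M : Type*} [TopologicalSpace M]
  [ChartedSpace E M] [IsManifold 𝓘(ℝ, E) ∞ M] (S : SubLorentzianStructure E M)

theorem contDiffAt_chartHamiltonian {x₀ : M} {z : E × (E →L[ℝ] ℝ)}
    (hz : ContDiffAt ℝ ∞ (fun z : E × (E →L[ℝ] ℝ) => S.chartSharp x₀ z.1 z.2) z) :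
    ContDiffAt ℝ ∞ (fun z : E × (E →L[ℝ] ℝ) => S.chartHamiltonian x₀ z.1 z.2) z := by
  simp only [chartHamiltonian_eq]
  exact contDiffAt_const.mul (contDiffAt_snd.clm_apply hz)

theorem fderiv_chartHamiltonian_apply {x₀ : M} {x : E} {ξ : E →L[ℝ] ℝ}
    (hz : ContDiffAt ℝ ∞ (fun z : E × (E →L[ℝ] ℝ) => S.chartSharp x₀ z.1 z.2) (x, ξ))
    (y : E) (μ : E →L[ℝ] ℝ) :
    fderiv ℝ (fun z : E × (E →L[ℝ] ℝ) => S.chartHamiltonian x₀ z.1 z.2) (x, ξ) (y, μ) =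
      fderiv ℝ (fun x => S.chartHamiltonian x₀ x ξ) x y + μ (S.chartSharp x₀ x ξ) := by
  have hd := ((S.contDiffAt_chartHamiltonian hz).differentiableAt (by simp)).hasFDerivAt
  have h1 : HasFDerivAt (fun x => S.chartHamiltonian x₀ x ξ) _ x :=
    hd.comp (f := fun x => (x, ξ)) x (hasFDerivAt_prodMk_left x ξ)
  have h2 : HasFDerivAt (fun ξ => S.chartHamiltonian x₀ x ξ) _ ξ :=
    hd.comp (f := fun ξ => (x, ξ)) ξ (hasFDerivAt_prodMk_right x ξ)
  rw [← fderiv_chartHamiltonian_covector, h1.fderiv, h2.fderiv, ContinuousLinearMap.comp_apply,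
    ContinuousLinearMap.comp_apply, ← map_add]
  simp

/-- In the chart at one of its points, a Hamiltonian trajectory extends to a solution of the
Hamiltonian system that is defined on an open interval. -/
theorem IsHamiltonianTrajectory.exists_extension {γ : ℝ → M} {lam : ∀ t, CotangentSpaceAt E (γ t)}
    {a b t : ℝ} (hΓ : S.IsHamiltonianTrajectory γ lam a b) (ht : t ∈ Icc a b) :
    ∃ (X : ℝ → E) (P : ℝ → E →L[ℝ] ℝ),
      (∀ᶠ s in 𝓝 t, HasDerivAt X (S.chartSharp (γ t) (X s) (P s)) s) ∧
      (∀ᶠ s in 𝓝 t, HasDerivAt P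
        (-fderiv ℝ (fun x => S.chartHamiltonian (γ t) x (P s)) (X s)) s) ∧
      (X t = extChartAt 𝓘(ℝ, E) (γ t) (γ t) ∧ P t = covectorInChart E (γ t) (γ t) (lam t)) ∧
      ∀ᶠ s in 𝓝[Icc a b] t, γ s ∈ (chartAt E (γ t)).source ∧
        X s = extChartAt 𝓘(ℝ, E) (γ t) (γ s) ∧
        P s = covectorInChart E (γ t) (γ s) (lam s) := by
  set φ := extChartAt 𝓘(ℝ, E) (γ t) with hφ
  set H : E × (E →L[ℝ] ℝ) → ℝ := fun z => S.chartHamiltonian (γ t) z.1 z.2 with hH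
  set z : ℝ → E × (E →L[ℝ] ℝ) := fun s => (φ (γ s), covectorInChart E (γ t) (γ s) (lam s)) with hz
  -- The `x`-derivative is written through the full derivative of `H`, which makes the smoothness of
  -- `V` visible; `hVe` returns to the partial derivative.
  let V : E × (E →L[ℝ] ℝ) → E × (E →L[ℝ] ℝ) := fun z =>
    (S.chartSharp (γ t) z.1 z.2, -(fderiv ℝ H z ∘L ContinuousLinearMap.inl ℝ E (E →L[ℝ] ℝ)))
  have hsm := S.contDiffAt_chartSharp (γ t)
  have hVe : ∀ z : E × (E →L[ℝ] ℝ), ContDiffAt ℝ ∞ (fun z : E × (E →L[ℝ] ℝ) =>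
      S.chartSharp (γ t) z.1 z.2) z → V z =
      (S.chartSharp (γ t) z.1 z.2, -fderiv ℝ (fun x => S.chartHamiltonian (γ t) x z.2) z.1) := by
    intro z hz
    refine Prod.ext rfl (congrArg Neg.neg (ContinuousLinearMap.ext fun y => ?_))
    have := S.fderiv_chartHamiltonian_apply hz y 0
    simpa using this
  have hV : ContDiffAt ℝ 1 V (z t) := by
    have h1 := hsm.self_of_nhds (covectorInChart E (γ t) (γ t) (lam t))
    have h2 : ContDiffAt ℝ 1 (fderiv ℝ H) (z t) :=
      (S.contDiffAt_chartHamiltonian h1).fderiv_right (m := 1) (by norm_num; exact WithTop.coe_le_coe.mpr le_top)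
    exact (h1.of_le (by norm_num)).prodMk (h2.clm_comp contDiffAt_const).neg
  have hγc : ContinuousWithinAt γ (Icc a b) t := hΓ.1 t ht
  have hsrc : ∀ᶠ s in 𝓝[Icc a b] t, γ s ∈ (chartAt E (γ t)).source :=
    hγc.eventually ((chartAt E (γ t)).open_source.mem_nhds (mem_chart_source E (γ t)))
  have hφc : ContinuousWithinAt (fun s => φ (γ s)) (Icc a b) t :=
    (continuousAt_extChartAt (γ t)).comp_continuousWithinAt hγc
  have hsm' : ∀ᶠ s in 𝓝[Icc a b] t, ContDiffAt ℝ ∞ (fun z : E × (E →L[ℝ] ℝ) =>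
      S.chartSharp (γ t) z.1 z.2) (z s) :=
    (hφc.eventually hsm).mono fun s hs => hs _
  have hzd : ∀ᶠ s in 𝓝[Icc a b] t, HasDerivWithinAt z (V (z s)) (Icc a b) s := by
    filter_upwards [hsrc, hsm', self_mem_nhdsWithin] with s hs hss hsI
    obtain ⟨⟨v, hv, hvζ⟩, hp⟩ := hΓ.2 (γ t) s hsI hs
    rw [hVe _ hss]
    refine HasDerivWithinAt.prodMk ?_ hp
    have : v = S.chartSharp (γ t) (z s).1 (z s).2 := by
      refine (SeparatingDual.eq_iff_forall_dual_eq (R := ℝ)).mpr fun ζ => ?_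
      rw [hvζ ζ, fderiv_chartHamiltonian_covector]
    rwa [this] at hv
  obtain ⟨w, hwt, hw, hwz⟩ := exists_eventually_hasDerivAt_extend hV ht hzd
  have hwc := hw.self_of_nhds.continuousAt
  have hws : ∀ᶠ s in 𝓝 t, ContDiffAt ℝ ∞ (fun z : E × (E →L[ℝ] ℝ) =>
      S.chartSharp (γ t) z.1 z.2) (w s) := by
    have : ContinuousAt (fun s => (w s).1) t := continuousAt_fst.comp hwc
    have h1 : Tendsto (fun s => (w s).1) (𝓝 t) (𝓝 (φ (γ t))) := by
      have h2 := this.tendsto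
      rwa [hwt] at h2
    exact (h1.eventually hsm).mono fun s hs => hs _
  refine ⟨fun s => (w s).1, fun s => (w s).2, ?_, ?_, ?_, ?_⟩
  · filter_upwards [hw] with s hs using hs.fst
  · filter_upwards [hw, hws] with s hs hs2
    have := hs.snd
    rwa [hVe _ hs2] at this
  · simp only [hwt]
    exact ⟨rfl, rfl⟩
  · filter_upwards [hsrc, hwz] with s hs hs2
    simp only [hs2]
    exact ⟨hs, rfl, rfl⟩

/-- The Hamiltonian is constant along solutions of the Hamiltonian system. -/
theorem eventually_chartHamiltonian_eq {x₀ : M} {X : ℝ → E} {P : ℝ → E →L[ℝ] ℝ} {t : ℝ}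
    (hXt : X t = extChartAt 𝓘(ℝ, E) x₀ x₀)
    (hX : ∀ᶠ s in 𝓝 t, HasDerivAt X (S.chartSharp x₀ (X s) (P s)) s)
    (hP : ∀ᶠ s in 𝓝 t, HasDerivAt P (-fderiv ℝ (fun x => S.chartHamiltonian x₀ x (P s)) (X s)) s) :
    ∀ᶠ s in 𝓝 t, S.chartHamiltonian x₀ (X s) (P s) = S.chartHamiltonian x₀ (X t) (P t) := by
  have hsm : ∀ᶠ s in 𝓝 t, ContDiffAt ℝ ∞ (fun z : E × (E →L[ℝ] ℝ) => S.chartSharp x₀ z.1 z.2)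
      (X s, P s) := by
    have h1 : Tendsto X (𝓝 t) (𝓝 (extChartAt 𝓘(ℝ, E) x₀ x₀)) := by
      rw [← hXt]; exact hX.self_of_nhds.continuousAt
    exact (h1.eventually (S.contDiffAt_chartSharp x₀)).mono fun s hs => hs _
  have hd : ∀ᶠ s in 𝓝 t, HasDerivAt (fun s => S.chartHamiltonian x₀ (X s) (P s)) 0 s := by
    filter_upwards [hX, hP, hsm] with s h1 h2 h3
    have h4 : HasDerivAt (fun s => S.chartHamiltonian x₀ (X s) (P s)) _ s :=
      ((S.contDiffAt_chartHamiltonian h3).differentiableAt (by simp)).hasFDerivAt.comp_hasDerivAt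
        (f := fun s => (X s, P s)) s (h1.prodMk h2)
    rw [S.fderiv_chartHamiltonian_apply h3] at h4
    simpa using h4
  obtain ⟨δ, hδ, H⟩ := Metric.eventually_nhds_iff_ball.mp hd
  filter_upwards [Metric.ball_mem_nhds t hδ] with s hs
  exact Metric.isOpen_ball.is_const_of_deriv_eq_zero (convex_ball t δ).isPreconnected
    (fun r hr => (H r hr).differentiableAt.differentiableWithinAt)
    (fun r hr => (H r hr).deriv) hs (Metric.mem_ball_self hδ)

/-- `H` is quadratic in the covector, so Euler's identity gives `P (X') = 2H`; in particular `X' t ≠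
0` when the energy is nonzero. -/
theorem exists_chart_calibration {x₀ : M} {X : ℝ → E} {P : ℝ → E →L[ℝ] ℝ} {t : ℝ}
    (hXt : X t = extChartAt 𝓘(ℝ, E) x₀ x₀)
    (hX : ∀ᶠ s in 𝓝 t, HasDerivAt X (S.chartSharp x₀ (X s) (P s)) s)
    (hP : ∀ᶠ s in 𝓝 t, HasDerivAt P (-fderiv ℝ (fun x => S.chartHamiltonian x₀ x (P s)) (X s)) s)
    (h0 : S.chartHamiltonian x₀ (X t) (P t) ≠ 0) :
    ∃ (θ f : E → ℝ) (F : E → E →L[ℝ] ℝ), θ (X t) = t ∧ F (X t) = P t ∧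
      ContinuousAt F (X t) ∧
      (∀ᶠ x in 𝓝 (X t), HasFDerivAt f (F x) x ∧ ContinuousAt θ x ∧
        S.chartHamiltonian x₀ x (F x) + ‖x - X (θ x)‖ ^ 2 ≤
          S.chartHamiltonian x₀ (X t) (P t)) ∧
      ∀ᶠ s in 𝓝 t, θ (X s) = s ∧
        f (X s) = 2 * S.chartHamiltonian x₀ (X t) (P t) * (s - t) := by
  have hsm : ∀ᶠ s in 𝓝 t, ContDiffAt ℝ ∞ (fun z : E × (E →L[ℝ] ℝ) => S.chartSharp x₀ z.1 z.2)
      (X s, P s) := by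
    have h1 : Tendsto X (𝓝 t) (𝓝 (extChartAt 𝓘(ℝ, E) x₀ x₀)) := by
      rw [← hXt]; exact hX.self_of_nhds.continuousAt
    exact (h1.eventually (S.contDiffAt_chartSharp x₀)).mono fun s hs => hs _
  have hXP : ContinuousAt (fun s => (X s, P s)) t :=
    hX.self_of_nhds.continuousAt.prodMk hP.self_of_nhds.continuousAt
  have hHs := S.contDiffAt_chartHamiltonian hsm.self_of_nhds
  have hH2 : ContDiffAt ℝ 2 (fun z : E × (E →L[ℝ] ℝ) => S.chartHamiltonian x₀ z.1 z.2)
      (X t, P t) := hHs.of_le (WithTop.coe_le_coe.mpr le_top)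
  refine exists_calibration (H := fun z => S.chartHamiltonian x₀ z.1 z.2)
    (h := S.chartHamiltonian x₀ (X t) (P t)) hH2 hX hP ?_ ?_ ?_ ?_
    (S.eventually_chartHamiltonian_eq hXt hX hP) ?_
  · exact ContinuousAt.comp (f := fun s => (X s, P s)) hsm.self_of_nhds.continuousAt hXP
  · have h1 : ContinuousAt (fun z : E × (E →L[ℝ] ℝ) =>
        -(fderiv ℝ (fun z : E × (E →L[ℝ] ℝ) => S.chartHamiltonian x₀ z.1 z.2) z ∘L
          ContinuousLinearMap.inl ℝ E (E →L[ℝ] ℝ))) (X t, P t) :=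
      (((hH2.fderiv_right (m := 1) (by norm_num)).continuousAt).clm_comp continuousAt_const).neg
    refine (ContinuousAt.comp (f := fun s => (X s, P s)) h1 hXP).congr ?_
    filter_upwards [hsm] with s hs
    refine congrArg Neg.neg (ContinuousLinearMap.ext fun y => ?_)
    have := S.fderiv_chartHamiltonian_apply hs y 0
    simpa using this
  · intro hv
    exact h0 (by rw [chartHamiltonian_eq, hv]; simp)
  · filter_upwards [hsm] with s hs y μ
    rw [S.fderiv_chartHamiltonian_apply hs, _root_.neg_apply]
    ring
  · filter_upwards [S.eventually_chartHamiltonian_eq hXt hX hP] with s hs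
    rw [← hs, chartHamiltonian_eq]
    ring

end SubLorentzianStructure

/-! ### Absolutely continuous functions with negative derivative -/

theorem LipschitzOnWith.comp_absolutelyContinuousOnInterval {G G' : Type*} [PseudoMetricSpace G]
    [PseudoMetricSpace G'] {K : NNReal} {f : G → G'} {s : Set G} {u : ℝ → G} {α β : ℝ}
    (hf : LipschitzOnWith K f s) (hu : AbsolutelyContinuousOnInterval u α β)
    (hus : ∀ r ∈ uIcc α β, u r ∈ s) :
    AbsolutelyContinuousOnInterval (fun r => f (u r)) α β := by
  have h := Tendsto.const_mul (K : ℝ) hu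
  rw [mul_zero] at h
  refine squeeze_zero' (Eventually.of_forall fun I => Finset.sum_nonneg fun _ _ => dist_nonneg)
    ?_ h
  filter_upwards [mem_inf_of_right (mem_principal_self _)] with I hI
  rw [Finset.mul_sum]
  exact Finset.sum_le_sum fun i hi =>
    hf.dist_le_mul _ (hus _ (hI.1 i hi).1) _ (hus _ (hI.1 i hi).2)

section DecreasingFunction

variable {k D n : ℝ → ℝ} {α β c : ℝ} {G : ℝ → Prop}

theorem AbsolutelyContinuousOnInterval.strictAntiOn_of_ae_deriv_neg
    (hk : AbsolutelyContinuousOnInterval k α β)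
    (hD : ∀ᵐ s ∂volume.restrict (Icc α β), deriv k s < 0) : StrictAntiOn k (Icc α β) := by
  intro x hx y hy hxy
  have hsub : Icc x y ⊆ Icc α β := Icc_subset_Icc hx.1 hy.2
  have hxyk : AbsolutelyContinuousOnInterval k x y := hk.mono (by
    rw [uIcc_of_le hxy.le, uIcc_of_le (hx.1.trans hx.2)]; exact hsub)
  have hD' : ∀ᵐ s ∂volume.restrict (Ioc x y), deriv k s < 0 :=
    ae_restrict_of_ae_restrict_of_subset (Ioc_subset_Icc_self.trans hsub) hD
  have hpos : 0 < ∫ s in x..y, -deriv k s := by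
    refine (intervalIntegral.integral_pos_iff_support_of_nonneg_ae' (by
      rw [uIoc_of_le hxy.le]
      filter_upwards [hD'] with s hs using (neg_pos.mpr hs).le)
      hxyk.intervalIntegrable_deriv.neg).mpr ⟨hxy, ?_⟩
    have : (Function.support (fun s => -deriv k s) ∩ Ioc x y : Set ℝ) =ᵐ[volume] Ioc x y := by
      rw [ae_restrict_iff' measurableSet_Ioc] at hD'
      filter_upwards [hD'] with s hs
      refine propext ⟨fun h => h.2, fun h => ⟨?_, h⟩⟩
      exact neg_ne_zero.mpr (hs h).ne
    refine (measure_congr this).symm ▸ ?_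
    rw [Real.volume_Ioc]
    simpa using hxy
  rw [intervalIntegral.integral_neg, hxyk.integral_deriv_eq_sub] at hpos
  linarith

theorem lintegral_neg_deriv_div (hαβ : α ≤ β) (hk : AbsolutelyContinuousOnInterval k α β)
    (hc : 0 < c) (hD : ∀ᵐ s ∂volume.restrict (Icc α β), deriv k s < 0) :
    ∫⁻ s in Icc α β, ENNReal.ofReal (-deriv k s / c) = ENNReal.ofReal ((k α - k β) / c) := by
  have hint : IntegrableOn (fun s => -deriv k s / c) (Icc α β) := by
    rw [integrableOn_Icc_iff_integrableOn_Ioc]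
    have := (hk.intervalIntegrable_deriv.neg.div_const c).1
    exact this
  rw [← ofReal_integral_eq_lintegral_ofReal hint (by
    filter_upwards [hD] with s hs using (div_pos (neg_pos.mpr hs) hc).le),
    integral_Icc_eq_integral_Ioc, ← intervalIntegral.integral_of_le hαβ,
    intervalIntegral.integral_div, intervalIntegral.integral_neg, hk.integral_deriv_eq_sub,
    neg_sub]

theorem lintegral_le_of_ae_deriv_le (hαβ : α ≤ β) (hk : AbsolutelyContinuousOnInterval k α β)
    (hc : 0 < c) (hD : ∀ᵐ s ∂volume.restrict (Icc α β), deriv k s < 0)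
    (hn : ∀ᵐ s ∂volume.restrict (Icc α β), deriv k s ≤ -(c * n s)) :
    ∫⁻ s in Icc α β, ENNReal.ofReal (n s) ≤ ENNReal.ofReal ((k α - k β) / c) := by
  rw [← lintegral_neg_deriv_div hαβ hk hc hD]
  refine lintegral_mono_ae ?_
  filter_upwards [hn] with s hs
  refine ENNReal.ofReal_le_ofReal ?_
  rw [le_div_iff₀ hc]
  linarith

/-- Two ordered integrands with the same finite integral agree almost everywhere. This is the
equality case of the length bound. -/
theorem ae_deriv_eq_of_lintegral_eq (hαβ : α ≤ β) (hk : AbsolutelyContinuousOnInterval k α β)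
    (hc : 0 < c) (hD : ∀ᵐ s ∂volume.restrict (Icc α β), deriv k s < 0)
    (hn : ∀ᵐ s ∂volume.restrict (Icc α β), deriv k s ≤ -(c * n s))
    (heq : ∫⁻ s in Icc α β, ENNReal.ofReal (n s) = ENNReal.ofReal ((k α - k β) / c)) :
    ∀ᵐ s ∂volume.restrict (Icc α β), deriv k s = -(c * n s) := by
  have h1 := lintegral_neg_deriv_div hαβ hk hc hD
  have h2 : (fun s => ENNReal.ofReal (n s)) =ᵐ[volume.restrict (Icc α β)]
      fun s => ENNReal.ofReal (-deriv k s / c) := by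
    refine ae_eq_of_ae_le_of_lintegral_le ?_ (by rw [heq]; exact ENNReal.ofReal_ne_top)
      (((measurable_deriv k).neg.div_const c).ennreal_ofReal.aemeasurable) (by rw [h1, heq])
    filter_upwards [hn] with s hs
    refine ENNReal.ofReal_le_ofReal ?_
    rw [le_div_iff₀ hc]
    linarith
  filter_upwards [h2, hD] with s hs hDs
  -- Strict positivity rules out truncation by `ENNReal.ofReal`, so the equality descends to real
  -- numbers.
  have h3 : 0 < -deriv k s / c := div_pos (neg_pos.mpr hDs) hc
  have h4 : 0 < n s := by
    rw [← ENNReal.ofReal_pos, hs, ENNReal.ofReal_pos]; exact h3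
  have h5 := (ENNReal.ofReal_eq_ofReal_iff h4.le h3.le).mp hs
  rw [h5]
  field_simp

end DecreasingFunction

/-- A relative neighbourhood of `t` meets the open interval in a set of positive measure, even when
`t` is an endpoint. -/
theorem exists_of_ae_restrict_Icc_of_eventually {a b t : ℝ} (hab : a < b) (ht : t ∈ Icc a b)
    {Q R : ℝ → Prop} (hQ : ∀ᵐ s ∂volume.restrict (Icc a b), Q s)
    (hR : ∀ᶠ s in 𝓝[Icc a b] t, R s) : ∃ s ∈ Ioo a b, Q s ∧ R s := by
  obtain ⟨o, ho, hto, hoR⟩ := mem_nhdsWithin.mp hR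
  have hne : (o ∩ Ioo a b).Nonempty := by
    rw [← closure_Ioo hab.ne] at ht
    exact mem_closure_iff.mp ht o ho hto
  have hpos : 0 < volume (o ∩ Ioo a b) := (ho.inter isOpen_Ioo).measure_pos volume hne
  rw [ae_restrict_iff' measurableSet_Icc] at hQ
  by_contra! hcon
  have : volume (o ∩ Ioo a b) = 0 := by
    refine measure_mono_null (fun s hs => ?_) (ae_iff.mp hQ)
    intro h
    exact hcon s hs.2 (h (Ioo_subset_Icc_self hs.2)) (hoR ⟨hs.1, Ioo_subset_Icc_self hs.2⟩)
  exact hpos.ne' this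

/-! ### Velocities and covectors in a chart -/

section Chart

variable {E : Type*} [NormedAddCommGroup E] [NormedSpace ℝ E]
    {M : Type*} [TopologicalSpace M] [ChartedSpace E M]

theorem vectorFieldInChart_extChartAt {x₀ p : M} (hp : p ∈ (chartAt E x₀).source)
    (Z : ∀ p : M, TangentSpace 𝓘(ℝ, E) p) :
    vectorFieldInChart x₀ Z (extChartAt 𝓘(ℝ, E) x₀ p) = tangentChart E x₀ p (Z p) := by
  -- The base point `φ⁻¹(φ p)` equals `p` only propositionally, so the dependent types force a
  -- generalization over `q`.
  have h : ∀ q, q = p → tangentChart E x₀ q (Z q) = tangentChart E x₀ p (Z p) := by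
    rintro _ rfl; rfl
  exact h _ ((extChartAt 𝓘(ℝ, E) x₀).left_inv (by simpa using hp))

variable [IsManifold 𝓘(ℝ, E) ∞ M]

theorem hasDerivAt_extChartAt_comp {x₀ : M} {η : ℝ → M} {s : ℝ}
    (hs : η s ∈ (chartAt E x₀).source) (hη : MDifferentiableAt 𝓘(ℝ, ℝ) 𝓘(ℝ, E) η s) :
    HasDerivAt (fun r => extChartAt 𝓘(ℝ, E) x₀ (η r))
      (tangentChart E x₀ (η s) (curveVelocity E η s)) s := by
  have : IsManifold 𝓘(ℝ, E) 1 M := IsManifold.of_le (n := ∞) (by norm_num)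
  have h := (mdifferentiableAt_extChartAt (I := 𝓘(ℝ, E)) hs).hasMFDerivAt.comp s hη.hasMFDerivAt
  have h2 : HasFDerivAt (fun r => extChartAt 𝓘(ℝ, E) x₀ (η r))
      ((tangentChart E x₀ (η s)).comp (mfderiv 𝓘(ℝ, ℝ) 𝓘(ℝ, E) η s) : ℝ →L[ℝ] E) s :=
    hasMFDerivAt_iff_hasFDerivAt.mp h
  exact h2.hasDerivAt

theorem isInvertible_tangentChart {x₀ p : M} (hp : p ∈ (chartAt E x₀).source) :
    (tangentChart E x₀ p).IsInvertible := by
  have : IsManifold 𝓘(ℝ, E) 1 M := IsManifold.of_le (n := ∞) (by norm_num)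
  exact isInvertible_mfderiv_extChartAt (by simpa using hp)

end Chart

namespace SubLorentzianStructure

variable {E : Type*} [NormedAddCommGroup E] [NormedSpace ℝ E]
    [FiniteDimensional ℝ E] {M : Type*} [TopologicalSpace M]
  [ChartedSpace E M] [IsManifold 𝓘(ℝ, E) ∞ M] (S : SubLorentzianStructure E M)

theorem chartHamiltonian_extChartAt {x₀ p : M} (hp : p ∈ (chartAt E x₀).source)
    (ξ : E →L[ℝ] ℝ) : S.chartHamiltonian x₀ (extChartAt 𝓘(ℝ, E) x₀ p) ξ =
      S.hamiltonian p (ξ ∘L tangentChart E x₀ p) := by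
  have h : ∀ q, q = p → S.hamiltonian q (ξ ∘L tangentChart E x₀ q) =
      S.hamiltonian p (ξ ∘L tangentChart E x₀ p) := by rintro _ rfl; rfl
  exact h _ ((extChartAt 𝓘(ℝ, E) x₀).left_inv (by simpa using hp))

theorem chartSharp_extChartAt {x₀ p : M} (hp : p ∈ (chartAt E x₀).source)
    (ξ : E →L[ℝ] ℝ) : S.chartSharp x₀ (extChartAt 𝓘(ℝ, E) x₀ p) ξ =
      tangentChart E x₀ p (S.sharp p (ξ ∘L tangentChart E x₀ p)) := by
  have h : ∀ q, q = p → tangentChart E x₀ q (S.sharp q (ξ ∘L tangentChart E x₀ q)) =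
      tangentChart E x₀ p (S.sharp p (ξ ∘L tangentChart E x₀ p)) := by rintro _ rfl; rfl
  exact h _ ((extChartAt 𝓘(ℝ, E) x₀).left_inv (by simpa using hp))

theorem two_mul_hamiltonian (p : M) (ξ : CotangentSpaceAt E p) :
    S.g p (S.sharp p ξ) (S.sharp p ξ) = 2 * S.hamiltonian p ξ := by
  rw [hamiltonian]; ring

/-- A covector in the interior of the dual cone is negative on the cone, and it satisfies there the
reverse Cauchy-Schwarz inequality. -/
theorem apply_le_of_hamiltonian_neg {p : M} {ξ : CotangentSpaceAt E p}
    (hξ : S.hamiltonian p ξ < 0) (hX : ξ (S.X p : TangentSpace 𝓘(ℝ, E) p) < 0)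
    {v : TangentSpace 𝓘(ℝ, E) p} (hv : S.IsNonspacelike p v) (hfd : S.IsFutureDirected p v) :
    ξ v < 0 ∧ ξ v ≤ -(√(-(2 * S.hamiltonian p ξ)) * S.vnorm p v) := by
  obtain ⟨hD, hv⟩ := hv
  obtain ⟨_, hfd⟩ := hfd
  have hu : S.g p (S.sharp p ξ) (S.sharp p ξ) < 0 := by
    rw [two_mul_hamiltonian]; linarith
  have huX : S.g p (S.sharp p ξ) (S.X p) < 0 := by rwa [g_sharp]
  have hξv : ξ v = S.g p (S.sharp p ξ) ⟨v, hD⟩ := by rw [g_sharp]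
  refine ⟨?_, ?_⟩
  · rw [hξv]
    exact LinearMap.BilinForm.neg_of_mem_timecone (S.symm p) (S.index_eq_one p) (S.timelike_X p)
      hu hv huX hfd
  · have := LinearMap.BilinForm.apply_le_neg_sqrt_mul_sqrt (S.symm p) (S.index_eq_one p)
      (S.timelike_X p) hu hv huX hfd
    rw [abs_of_neg hu, two_mul_hamiltonian] at this
    rwa [hξv, vnorm, dif_pos hD]

theorem vnorm_nonneg (p : M) (v : TangentSpace 𝓘(ℝ, E) p) : 0 ≤ S.vnorm p v := by
  rw [vnorm]; split_ifs <;> positivity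

theorem apply_lt_of_hamiltonian_lt {p : M} {ξ : CotangentSpaceAt E p} {h : ℝ} (h0 : h < 0)
    (hξ : S.hamiltonian p ξ < h) (hX : ξ (S.X p : TangentSpace 𝓘(ℝ, E) p) < 0)
    {v : TangentSpace 𝓘(ℝ, E) p} (hv : S.IsNonspacelike p v) (hfd : S.IsFutureDirected p v) :
    ξ v < -(√(-(2 * h)) * S.vnorm p v) := by
  obtain ⟨h1, h2⟩ := S.apply_le_of_hamiltonian_neg (hξ.trans h0) hX hv hfd
  -- For a null vector the square root gives nothing strict; strictness then comes from `ξ v < 0`.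
  rcases (S.vnorm_nonneg p v).eq_or_lt with h3 | h3
  · rw [← h3]; simpa using h1
  · refine h2.trans_lt (neg_lt_neg (mul_lt_mul_of_pos_right ?_ h3))
    exact Real.sqrt_lt_sqrt (by linarith) (by linarith)

theorem apply_le_of_hamiltonian_le {p : M} {ξ : CotangentSpaceAt E p} {h : ℝ} (h0 : h < 0)
    (hξ : S.hamiltonian p ξ ≤ h) (hX : ξ (S.X p : TangentSpace 𝓘(ℝ, E) p) < 0)
    {v : TangentSpace 𝓘(ℝ, E) p} (hv : S.IsNonspacelike p v) (hfd : S.IsFutureDirected p v) :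
    ξ v ≤ -(√(-(2 * h)) * S.vnorm p v) := by
  refine (S.apply_le_of_hamiltonian_neg (hξ.trans_lt h0) hX hv hfd).2.trans
    (neg_le_neg (mul_le_mul_of_nonneg_right ?_ (S.vnorm_nonneg p v)))
  exact Real.sqrt_le_sqrt (by linarith)

/-- The velocity of the projection of a solution of the Hamiltonian system. -/
theorem eventually_curveVelocity_eq_sharp {x₀ : M} {γ : ℝ → M} {a b t : ℝ} {X : ℝ → E}
    {P : ℝ → E →L[ℝ] ℝ}
    (hX : ∀ᶠ s in 𝓝 t, HasDerivAt X (S.chartSharp x₀ (X s) (P s)) s)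
    (hγ : ∀ᶠ s in 𝓝[Icc a b] t, γ s ∈ (chartAt E x₀).source ∧
      X s = extChartAt 𝓘(ℝ, E) x₀ (γ s)) :
    ∀ᶠ s in 𝓝[Icc a b] t, s ∈ Ioo a b → MDifferentiableAt 𝓘(ℝ, ℝ) 𝓘(ℝ, E) γ s →
      curveVelocity E γ s = S.sharp (γ s) (P s ∘L tangentChart E x₀ (γ s)) := by
  have h1 := eventually_eventually_nhdsWithin.mpr hγ
  filter_upwards [hX.filter_mono nhdsWithin_le_nhds, h1, hγ] with s h2 h3 h4 hs hd
  rw [nhdsWithin_eq_nhds.mpr (Icc_mem_nhds hs.1 hs.2)] at h3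
  have h5 := hasDerivAt_extChartAt_comp h4.1 hd
  have h6 : HasDerivAt (fun r => extChartAt 𝓘(ℝ, E) x₀ (γ r)) _ s :=
    h2.congr_of_eventuallyEq (h3.mono fun r hr => hr.2.symm)
  have h7 := h5.unique h6
  rw [h4.2, S.chartSharp_extChartAt h4.1] at h7
  exact (isInvertible_tangentChart h4.1).injective h7

end SubLorentzianStructure

theorem IsAbsolutelyContinuousCurve.mono {E : Type*} [NormedAddCommGroup E] [NormedSpace ℝ E]
    {M : Type*} [TopologicalSpace M] [ChartedSpace E M] {γ : ℝ → M} {a b s₁ s₂ : ℝ}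
    (hγ : IsAbsolutelyContinuousCurve E γ a b) (h₁ : a ≤ s₁) (h₂ : s₂ ≤ b) :
    IsAbsolutelyContinuousCurve E γ s₁ s₂ :=
  ⟨hγ.1.mono (Icc_subset_Icc h₁ h₂), fun x₀ r₁ r₂ hr₁ hr hr₂ hs =>
    hγ.2 x₀ r₁ r₂ (h₁.trans hr₁) hr (hr₂.trans h₂) hs⟩

namespace SubLorentzianStructure

variable {E : Type*} [NormedAddCommGroup E] [NormedSpace ℝ E]
    [FiniteDimensional ℝ E] {M : Type*} [TopologicalSpace M]
  [ChartedSpace E M] [IsManifold 𝓘(ℝ, E) ∞ M] (S : SubLorentzianStructure E M)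

theorem IsTimelikeFDCurve.isNonspacelikeFDCurve {γ : ℝ → M} {a b s₁ s₂ : ℝ}
    (hγ : S.IsTimelikeFDCurve γ a b) (h₁ : a ≤ s₁) (h₂ : s₂ ≤ b) :
    S.IsNonspacelikeFDCurve γ s₁ s₂ := by
  refine ⟨hγ.1.mono h₁ h₂, ?_⟩
  filter_upwards [ae_restrict_of_ae_restrict_of_subset (Icc_subset_Icc h₁ h₂) hγ.2] with s hs
  obtain ⟨h1, ⟨hD, h2⟩, h3⟩ := hs
  exact ⟨h1, ⟨hD, h2.le⟩, h3⟩

/-- The extended lift of a timelike future directed normal extremal lies, at every time, in the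
interior of the dual cone. -/
theorem chartHamiltonian_neg_of_isTimelikeFDCurve {x₀ : M} {γ : ℝ → M} {a b t : ℝ} (hab : a < b)
    (ht : t ∈ Icc a b) {X : ℝ → E} {P : ℝ → E →L[ℝ] ℝ} (hXt : X t = extChartAt 𝓘(ℝ, E) x₀ x₀)
    (hX : ∀ᶠ s in 𝓝 t, HasDerivAt X (S.chartSharp x₀ (X s) (P s)) s)
    (hP : ∀ᶠ s in 𝓝 t, HasDerivAt P (-fderiv ℝ (fun x => S.chartHamiltonian x₀ x (P s)) (X s)) s)
    (hγ : ∀ᶠ s in 𝓝[Icc a b] t, γ s ∈ (chartAt E x₀).source ∧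
      X s = extChartAt 𝓘(ℝ, E) x₀ (γ s))
    (hfd : S.IsTimelikeFDCurve γ a b) :
    S.chartHamiltonian x₀ (X t) (P t) < 0 ∧
      P t (vectorFieldInChart x₀ (fun p => (S.X p : TangentSpace 𝓘(ℝ, E) p)) (X t)) < 0 := by
  have hvel := S.eventually_curveVelocity_eq_sharp hX hγ
  have hH := (S.eventually_chartHamiltonian_eq hXt hX hP).filter_mono
    (nhdsWithin_le_nhds (s := Icc a b))
  have hneg : S.chartHamiltonian x₀ (X t) (P t) < 0 := by
    -- The velocity is known to be timelike only almost everywhere; one such time suffices, as the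
    -- energy is constant.
    obtain ⟨s, hs, ⟨h1, ⟨hD, h2⟩, h3⟩, h4, h5, h6⟩ := exists_of_ae_restrict_Icc_of_eventually hab ht
      hfd.2 (hvel.and (hH.and hγ))
    have h7 := h4 hs h1
    rw [← h5, h6.2, S.chartHamiltonian_extChartAt h6.1, hamiltonian]
    have h8 : (⟨_, hD⟩ : S.D (γ s)) = S.sharp (γ s) (P s ∘L tangentChart E x₀ (γ s)) :=
      Subtype.ext h7
    rw [h8] at h2
    linarith
  refine ⟨hneg, ?_⟩
  have hXc : ContinuousAt X t := hX.self_of_nhds.continuousAt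
  have hvc : ContinuousAt (fun s => P s (vectorFieldInChart x₀
      (fun p => (S.X p : TangentSpace 𝓘(ℝ, E) p)) (X s))) t :=
    hP.self_of_nhds.continuousAt.clm_apply (ContinuousAt.comp_of_eq
      (continuousAt_vectorFieldInChart (mem_chart_source E x₀) S.continuous_X.continuousAt)
      hXc hXt)
  -- A zero pairing would make the timelike vector `P^♯` orthogonal to the time orientation. A
  -- positive one would persist nearby, against future directedness at some time.
  have hne : P t (vectorFieldInChart x₀ (fun p => (S.X p : TangentSpace 𝓘(ℝ, E) p)) (X t)) ≠ 0 := by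
    intro h0
    rw [hXt, vectorFieldInChart_extChartAt (mem_chart_source E x₀)] at h0
    rw [hXt, S.chartHamiltonian_extChartAt (mem_chart_source E x₀), hamiltonian] at hneg
    have h1 : S.g x₀ (S.sharp x₀ (P t ∘L tangentChart E x₀ x₀)) (S.X x₀) = 0 := by
      rw [g_sharp]; exact h0
    have h2 := LinearMap.BilinForm.nonneg_of_sigNeg_eq_one (S.symm x₀) (S.index_eq_one x₀)
      (S.timelike_X x₀) h1
    linarith
  refine lt_of_le_of_ne (not_lt.mp fun hpos => ?_) hne
  obtain ⟨s, hs, ⟨h1, ⟨hD, h2⟩, hD', h3⟩, h4, h5, h6⟩ :=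
    exists_of_ae_restrict_Icc_of_eventually hab ht hfd.2 (hvel.and
      (((hvc.eventually (lt_mem_nhds hpos)).filter_mono nhdsWithin_le_nhds).and hγ))
  have h7 := h4 hs h1
  have h8 : (⟨_, hD⟩ : S.D (γ s)) = S.sharp (γ s) (P s ∘L tangentChart E x₀ (γ s)) :=
    Subtype.ext h7
  rw [h8, g_sharp] at h3
  rw [h6.2, vectorFieldInChart_extChartAt h6.1] at h5
  exact lt_asymm h3 h5

/-! ### Length bound and uniqueness from a calibration -/

/-- A calibration on `U`: the function `f` decreases along the future directed curves in `U`, and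
it bounds their lengths. -/
theorem joiningCurve_of_calibration {x₀ : M} {U : Set M} {B : Set E} {f : E → ℝ}
    {F : E → E →L[ℝ] ℝ} {h : ℝ} {K : NNReal} (h0 : h < 0)
    (hU : ∀ p ∈ U, p ∈ (chartAt E x₀).source ∧ extChartAt 𝓘(ℝ, E) x₀ p ∈ B)
    (hlip : LipschitzOnWith K f B) (hf : ∀ x ∈ B, HasFDerivAt f (F x) x)
    (hF : ∀ x ∈ B, S.chartHamiltonian x₀ x (F x) ≤ h)
    (hFX : ∀ x ∈ B, F x (vectorFieldInChart x₀
      (fun p => (S.X p : TangentSpace 𝓘(ℝ, E) p)) x) < 0)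
    {q₁ q₂ : M} {η : ℝ → M} {α β : ℝ} (hη : S.IsJoiningCurve U q₁ q₂ η α β) :
    StrictAntiOn (fun s => f (extChartAt 𝓘(ℝ, E) x₀ (η s))) (Icc α β) ∧
    S.length η α β ≤ ENNReal.ofReal ((f (extChartAt 𝓘(ℝ, E) x₀ q₁) -
      f (extChartAt 𝓘(ℝ, E) x₀ q₂)) / √(-(2 * h))) ∧
    (S.length η α β = ENNReal.ofReal ((f (extChartAt 𝓘(ℝ, E) x₀ q₁) -
      f (extChartAt 𝓘(ℝ, E) x₀ q₂)) / √(-(2 * h))) →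
      ∀ᵐ s ∂volume.restrict (Icc α β), S.chartHamiltonian x₀ (extChartAt 𝓘(ℝ, E) x₀ (η s))
        (F (extChartAt 𝓘(ℝ, E) x₀ (η s))) = h) := by
  obtain ⟨hαβ, ⟨hac, hae⟩, hηU, rfl, rfl⟩ := hη
  have hc : 0 < √(-(2 * h)) := Real.sqrt_pos.mpr (by linarith)
  have hk : AbsolutelyContinuousOnInterval (fun s => f (extChartAt 𝓘(ℝ, E) x₀ (η s))) α β := by
    refine hlip.comp_absolutelyContinuousOnInterval
      (hac.2 x₀ α β le_rfl hαβ.le le_rfl fun s hs => (hU _ (hηU s hs)).1) fun s hs => ?_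
    rw [uIcc_of_le hαβ.le] at hs
    exact (hU _ (hηU s hs)).2
  have key : ∀ᵐ s ∂volume.restrict (Icc α β),
      deriv (fun s => f (extChartAt 𝓘(ℝ, E) x₀ (η s))) s < 0 ∧
      deriv (fun s => f (extChartAt 𝓘(ℝ, E) x₀ (η s))) s ≤
        -(√(-(2 * h)) * S.vnorm (η s) (curveVelocity E η s)) ∧
      (deriv (fun s => f (extChartAt 𝓘(ℝ, E) x₀ (η s))) s =
        -(√(-(2 * h)) * S.vnorm (η s) (curveVelocity E η s)) →
        S.chartHamiltonian x₀ (extChartAt 𝓘(ℝ, E) x₀ (η s))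
          (F (extChartAt 𝓘(ℝ, E) x₀ (η s))) = h) := by
    filter_upwards [hae, ae_restrict_mem measurableSet_Icc] with s ⟨hd, hns, hfd⟩ hs
    obtain ⟨hsrc, hB⟩ := hU _ (hηU s hs)
    have hderiv : HasDerivAt (fun s => f (extChartAt 𝓘(ℝ, E) x₀ (η s)))
        (F (extChartAt 𝓘(ℝ, E) x₀ (η s)) (tangentChart E x₀ (η s) (curveVelocity E η s))) s :=
      (hf _ hB).comp_hasDerivAt s (hasDerivAt_extChartAt_comp hsrc hd)
    have hH := hF _ hB
    have hX := hFX _ hB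
    rw [S.chartHamiltonian_extChartAt hsrc] at hH ⊢
    rw [vectorFieldInChart_extChartAt hsrc] at hX
    rw [hderiv.deriv]
    refine ⟨(S.apply_le_of_hamiltonian_neg (hH.trans_lt h0) hX hns hfd).1,
      S.apply_le_of_hamiltonian_le h0 hH hX hns hfd, fun heq => ?_⟩
    by_contra hne
    exact (S.apply_lt_of_hamiltonian_lt h0 (lt_of_le_of_ne hH hne) hX hns hfd).ne heq
  have k1 := key.mono fun s hs => hs.1
  have k2 := key.mono fun s hs => hs.2.1
  refine ⟨hk.strictAntiOn_of_ae_deriv_neg k1, lintegral_le_of_ae_deriv_le hαβ.le hk hc k1 k2,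
    fun heq => ?_⟩
  filter_upwards [key, ae_deriv_eq_of_lintegral_eq hαβ.le hk hc k1 k2 heq] with s h1 h2
  exact h1.2.2 h2

theorem length_eq_of_curveVelocity_eq_sharp {x₀ : M} {γ : ℝ → M} {P : ℝ → E →L[ℝ] ℝ} {h : ℝ}
    {s₁ s₂ : ℝ} (h0 : h ≤ 0)
    (hv : ∀ s ∈ Ioo s₁ s₂, MDifferentiableAt 𝓘(ℝ, ℝ) 𝓘(ℝ, E) γ s →
      curveVelocity E γ s = S.sharp (γ s) (P s ∘L tangentChart E x₀ (γ s)))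
    (hh : ∀ s ∈ Ioo s₁ s₂, S.hamiltonian (γ s) (P s ∘L tangentChart E x₀ (γ s)) = h)
    (hγ : S.IsNonspacelikeFDCurve γ s₁ s₂) :
    S.length γ s₁ s₂ = ENNReal.ofReal (√(-(2 * h)) * (s₂ - s₁)) := by
  have hIoo : volume.restrict (Icc s₁ s₂) = volume.restrict (Ioo s₁ s₂) :=
    (Measure.restrict_congr_set Ioo_ae_eq_Icc).symm
  have h1 : S.length γ s₁ s₂ = ∫⁻ _ in Icc s₁ s₂, ENNReal.ofReal (√(-(2 * h))) := by
    refine lintegral_congr_ae ?_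
    have h2 := hγ.2
    rw [hIoo] at h2 ⊢
    filter_upwards [h2, ae_restrict_mem measurableSet_Ioo] with s ⟨hd, ⟨hD, _⟩, _⟩ hs
    have h3 := hv s hs hd
    have h4 : (⟨_, hD⟩ : S.D (γ s)) = S.sharp (γ s) (P s ∘L tangentChart E x₀ (γ s)) :=
      Subtype.ext h3
    rw [vnorm, dif_pos hD, h4, two_mul_hamiltonian, hh s hs, abs_of_nonpos (by linarith)]
  rw [h1, lintegral_const, Measure.restrict_apply_univ, Real.volume_Icc,
    ENNReal.ofReal_mul (Real.sqrt_nonneg _)]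

/-- The arc attains the calibration bound: its speed is `√(-2h)` and `f` drops by `-2h(s₂ - s₁)`
along it. Any other maximizer attains it too and is thereby forced onto the curve `X`. -/
theorem isUniqueMaximizer_of_calibration {x₀ : M} {U : Set M} {B : Set E} {θ f : E → ℝ}
    {F : E → E →L[ℝ] ℝ} {X : ℝ → E} {P : ℝ → E →L[ℝ] ℝ} {γ : ℝ → M} {h t δ : ℝ} {K : NNReal}
    {s₁ s₂ : ℝ} (h0 : h < 0)
    (hU : ∀ p ∈ U, p ∈ (chartAt E x₀).source ∧ extChartAt 𝓘(ℝ, E) x₀ p ∈ B)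
    (hlip : LipschitzOnWith K f B) (hf : ∀ x ∈ B, HasFDerivAt f (F x) x)
    (hF : ∀ x ∈ B, S.chartHamiltonian x₀ x (F x) + ‖x - X (θ x)‖ ^ 2 ≤ h)
    (hFX : ∀ x ∈ B, F x (vectorFieldInChart x₀
      (fun p => (S.X p : TangentSpace 𝓘(ℝ, E) p)) x) < 0)
    (hθ : ∀ x ∈ B, ContinuousAt θ x ∧ θ x ∈ Metric.ball t δ)
    (hX : ∀ s ∈ Metric.ball t δ, ContinuousAt X s ∧ θ (X s) = s ∧ f (X s) = 2 * h * (s - t))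
    (hs₁ : s₁ ∈ Metric.ball t δ) (hs₂ : s₂ ∈ Metric.ball t δ) (h12 : s₁ < s₂)
    (hγU : ∀ s ∈ Icc s₁ s₂, γ s ∈ U ∧ X s = extChartAt 𝓘(ℝ, E) x₀ (γ s))
    (hv : ∀ s ∈ Ioo s₁ s₂, MDifferentiableAt 𝓘(ℝ, ℝ) 𝓘(ℝ, E) γ s →
      curveVelocity E γ s = S.sharp (γ s) (P s ∘L tangentChart E x₀ (γ s)))
    (hh : ∀ s ∈ Ioo s₁ s₂, S.hamiltonian (γ s) (P s ∘L tangentChart E x₀ (γ s)) = h)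
    (hγ : S.IsNonspacelikeFDCurve γ s₁ s₂) :
    S.IsUniqueMaximizer U γ s₁ s₂ := by
  have hF' : ∀ x ∈ B, S.chartHamiltonian x₀ x (F x) ≤ h := fun x hx =>
    (le_add_of_nonneg_right (sq_nonneg _)).trans (hF x hx)
  have hjoin : S.IsJoiningCurve U (γ s₁) (γ s₂) γ s₁ s₂ :=
    ⟨h12, hγ, fun s hs => (hγU s hs).1, rfl, rfl⟩
  have hc : 0 < √(-(2 * h)) := Real.sqrt_pos.mpr (by linarith)
  have hlen : S.length γ s₁ s₂ = ENNReal.ofReal ((f (extChartAt 𝓘(ℝ, E) x₀ (γ s₁)) -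
      f (extChartAt 𝓘(ℝ, E) x₀ (γ s₂))) / √(-(2 * h))) := by
    rw [S.length_eq_of_curveVelocity_eq_sharp h0.le hv hh hγ,
      ← (hγU s₁ (left_mem_Icc.mpr h12.le)).2, ← (hγU s₂ (right_mem_Icc.mpr h12.le)).2,
      (hX s₁ hs₁).2.2, (hX s₂ hs₂).2.2]
    congr 1
    rw [eq_div_iff hc.ne', mul_right_comm, Real.mul_self_sqrt (by linarith)]
    ring
  have hdist : S.length γ s₁ s₂ = S.dist U (γ s₁) (γ s₂) := by
    refine le_antisymm ?_ ?_
    · exact le_iSup_of_le γ (le_iSup_of_le s₁ (le_iSup_of_le s₂ (le_iSup_of_le hjoin le_rfl)))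
    · refine iSup_le fun η => iSup_le fun α => iSup_le fun β => iSup_le fun hη => ?_
      rw [hlen]
      exact (S.joiningCurve_of_calibration h0 hU hlip hf hF' hFX hη).2.1
  refine ⟨⟨hjoin, hdist⟩, fun η α β hη hα hβ => ?_⟩
  obtain ⟨hηj, hηl⟩ := hη
  have hαβ := hηj.1
  have hηU : ∀ s ∈ Icc α β, η s ∈ U := hηj.2.2.1
  obtain ⟨hanti, -, heq⟩ := S.joiningCurve_of_calibration h0 hU hlip hf hF' hFX hηj
  have hG := heq (by rw [hηl, hα, hβ, ← hdist, hlen])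
  have hφc : ContinuousOn (fun s => extChartAt 𝓘(ℝ, E) x₀ (η s)) (Icc α β) := fun s hs =>
    (continuousAt_extChartAt' (by simpa using (hU _ (hηU s hs)).1)).comp_continuousWithinAt
      (hηj.2.1.1.1 s hs)
  have hσc : ContinuousOn (fun s => θ (extChartAt 𝓘(ℝ, E) x₀ (η s))) (Icc α β) := fun s hs =>
    ContinuousAt.comp_continuousWithinAt (f := fun s => extChartAt 𝓘(ℝ, E) x₀ (η s))
      (hθ _ (hU _ (hηU s hs)).2).1 (hφc s hs)
  have hXσc : ContinuousOn (fun s => X (θ (extChartAt 𝓘(ℝ, E) x₀ (η s)))) (Icc α β) :=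
    fun s hs => ContinuousAt.comp_continuousWithinAt
      (f := fun s => θ (extChartAt 𝓘(ℝ, E) x₀ (η s)))
      (hX _ (hθ _ (hU _ (hηU s hs)).2).2).1 (hσc s hs)
  -- Equality in the bound leaves no room for the square in `hF`, so it vanishes almost everywhere,
  -- and everywhere by continuity.
  have hline : EqOn (fun s => extChartAt 𝓘(ℝ, E) x₀ (η s))
      (fun s => X (θ (extChartAt 𝓘(ℝ, E) x₀ (η s)))) (Icc α β) := by
    refine Measure.eqOn_Icc_of_ae_eq volume hαβ.ne ?_ hφc hXσc
    filter_upwards [hG, ae_restrict_mem measurableSet_Icc] with s h1 hs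
    have h2 := hF _ (hU _ (hηU s hs)).2
    rw [h1] at h2
    have h3 : ‖extChartAt 𝓘(ℝ, E) x₀ (η s) - X (θ (extChartAt 𝓘(ℝ, E) x₀ (η s)))‖ ^ 2 = 0 :=
      le_antisymm (by linarith) (sq_nonneg _)
    rw [sq_eq_zero_iff, norm_eq_zero, sub_eq_zero] at h3
    exact h3
  -- On the curve `f = 2h(θ - t)` with `h < 0`, and `f` decreases strictly along `η`.
  have hmono : StrictMonoOn (fun s => θ (extChartAt 𝓘(ℝ, E) x₀ (η s))) (Icc α β) := by
    intro x hx y hy hxy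
    have h1 : f (extChartAt 𝓘(ℝ, E) x₀ (η y)) < f (extChartAt 𝓘(ℝ, E) x₀ (η x)) := hanti hx hy hxy
    have h2 : ∀ s ∈ Icc α β, f (extChartAt 𝓘(ℝ, E) x₀ (η s)) =
        2 * h * (θ (extChartAt 𝓘(ℝ, E) x₀ (η s)) - t) := fun s hs => by
      have h3 := (hX _ (hθ _ (hU _ (hηU s hs)).2).2).2.2
      have h4 : extChartAt 𝓘(ℝ, E) x₀ (η s) = X (θ (extChartAt 𝓘(ℝ, E) x₀ (η s))) := hline hs
      rwa [← h4] at h3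
    rw [h2 y hy, h2 x hx] at h1
    change θ _ < θ _
    nlinarith
  have hσα : θ (extChartAt 𝓘(ℝ, E) x₀ (η α)) = s₁ := by
    rw [hα, ← (hγU s₁ (left_mem_Icc.mpr h12.le)).2, (hX s₁ hs₁).2.1]
  have hσβ : θ (extChartAt 𝓘(ℝ, E) x₀ (η β)) = s₂ := by
    rw [hβ, ← (hγU s₂ (right_mem_Icc.mpr h12.le)).2, (hX s₂ hs₂).2.1]
  refine ⟨fun s => θ (extChartAt 𝓘(ℝ, E) x₀ (η s)), hσc, hmono, hσα, hσβ, fun s hs => ?_⟩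
  have hσs : θ (extChartAt 𝓘(ℝ, E) x₀ (η s)) ∈ Icc s₁ s₂ := by
    rw [← hσα, ← hσβ]
    exact ⟨hmono.monotoneOn (left_mem_Icc.mpr hαβ.le) hs hs.1,
      hmono.monotoneOn hs (right_mem_Icc.mpr hαβ.le) hs.2⟩
  obtain ⟨hγs, hXs⟩ := hγU _ hσs
  refine (extChartAt 𝓘(ℝ, E) x₀).injOn (by simpa using (hU _ (hηU s hs)).1)
    (by simpa using (hU _ hγs).1) ?_
  rw [← hXs]
  exact hline hs

end SubLorentzianStructure

/-! ### The main theorem -/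

theorem mainTheorem1 {E : Type*} [NormedAddCommGroup E] [NormedSpace ℝ E]
    [FiniteDimensional ℝ E] {M : Type*} [TopologicalSpace M]
    [ChartedSpace E M] [IsManifold 𝓘(ℝ, E) ∞ M]
    (S : SubLorentzianStructure E M) {a b : ℝ} (hab : a < b) (γ : ℝ → M)
    (hγ : S.IsNormalExtremal γ a b) (hfd : S.IsTimelikeFDCurve γ a b) :
    ∀ t ∈ Icc a b, ∃ U : Set M, IsOpen U ∧ γ t ∈ U ∧
      ∀ s₁ ∈ connectedComponentIn (Icc a b ∩ γ ⁻¹' U) t,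
        ∀ s₂ ∈ connectedComponentIn (Icc a b ∩ γ ⁻¹' U) t,
          s₁ < s₂ → S.IsUniqueMaximizer U γ s₁ s₂ := by
  intro t ht
  obtain ⟨lam, hΓ⟩ := hγ
  obtain ⟨X, P, hX, hP, ⟨hXt, -⟩, hXP⟩ := hΓ.exists_extension S ht
  have hγX : ∀ᶠ s in 𝓝[Icc a b] t, γ s ∈ (chartAt E (γ t)).source ∧
      X s = extChartAt 𝓘(ℝ, E) (γ t) (γ s) := hXP.mono fun s hs => ⟨hs.1, hs.2.1⟩
  obtain ⟨h0, hFX0⟩ := S.chartHamiltonian_neg_of_isTimelikeFDCurve hab ht hXt hX hP hγX hfd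
  obtain ⟨θ, f, F, hθt, hFt, hFc, hcal, hθX⟩ := S.exists_chart_calibration hXt hX hP h0.ne
  have hH := S.eventually_chartHamiltonian_eq hXt hX hP
  have hvel := S.eventually_curveVelocity_eq_sharp hX hγX
  set h := S.chartHamiltonian (γ t) (X t) (P t) with hh
  obtain ⟨δ, hδ, hδ₁⟩ := Metric.eventually_nhds_iff_ball.mp
    ((hX.and (hθX.and hH)).and (eventually_nhdsWithin_iff.mp (hγX.and hvel)))
  have hFX : ∀ᶠ x in 𝓝 (X t), F x (vectorFieldInChart (γ t)
      (fun p => (S.X p : TangentSpace 𝓘(ℝ, E) p)) x) < 0 := by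
    have h1 : ContinuousAt (fun x => F x (vectorFieldInChart (γ t)
        (fun p => (S.X p : TangentSpace 𝓘(ℝ, E) p)) x)) (X t) := by
      refine hFc.clm_apply ?_
      rw [hXt]
      exact continuousAt_vectorFieldInChart (mem_chart_source E _) S.continuous_X.continuousAt
    exact h1.eventually (gt_mem_nhds (by simpa only [hFt] using hFX0))
  have hFn : ∀ᶠ x in 𝓝 (X t), ‖F x‖₊ < ‖F (X t)‖₊ + 1 :=
    hFc.nnnorm.eventually (gt_mem_nhds (lt_add_one _))
  -- The radius is `δ / 2` rather than `δ` so that the component `J` cannot leave the `δ`-ball, as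
  -- shown in `hJball`.
  have hθb : ∀ᶠ x in 𝓝 (X t), θ x ∈ Metric.ball t (δ / 2) :=
    hcal.self_of_nhds.2.1.eventually (by rw [hθt]; exact Metric.ball_mem_nhds t (half_pos hδ))
  obtain ⟨ρ, hρ, hB⟩ := Metric.eventually_nhds_iff_ball.mp
    (hcal.and (hFX.and (hFn.and hθb)))
  have hlip : LipschitzOnWith (‖F (X t)‖₊ + 1) f (Metric.ball (X t) ρ) :=
    (convex_ball _ _).lipschitzOnWith_of_nnnorm_hasFDerivWithin_le
      (fun x hx => (hB x hx).1.1.hasFDerivWithinAt) fun x hx => (hB x hx).2.2.1.le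
  set U : Set M := (chartAt E (γ t)).source ∩
    extChartAt 𝓘(ℝ, E) (γ t) ⁻¹' Metric.ball (X t) ρ with hU
  have htU : γ t ∈ U := ⟨mem_chart_source E _, by
    rw [mem_preimage, ← hXt]; exact Metric.mem_ball_self hρ⟩
  refine ⟨U, ?_, htU, ?_⟩
  · have := isOpen_extChartAt_preimage (I := 𝓘(ℝ, E)) (γ t) (Metric.isOpen_ball (x := X t) (ε := ρ))
    exact this
  have hball : Metric.ball t (δ / 2) ⊆ Metric.ball t δ := Metric.ball_subset_ball (by linarith)
  set J := connectedComponentIn (Icc a b ∩ γ ⁻¹' U) t with hJ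
  have hJs : J ⊆ Icc a b ∩ γ ⁻¹' U := connectedComponentIn_subset _ _
  have htJ : t ∈ J := mem_connectedComponentIn ⟨ht, htU⟩
  have hJo : OrdConnected J := isPreconnected_connectedComponentIn.ordConnected
  -- Within the `δ`-ball `s = θ (X s)`, and `θ` sends the chart image of `U` into the `δ / 2`-ball.
  -- Hence `J` misses the times at distance `δ / 2` from `t`, and being connected it stays inside
  -- them. Later returns of `γ` to `U` are thus excluded.
  have hloc : ∀ s ∈ J, s ∈ Metric.ball t δ → s ∈ Metric.ball t (δ / 2) := by
    intro s hs hsδ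
    have h1 := (hδ₁ s hsδ).2 (hJs hs).1
    have h2 := (hB _ (hJs hs).2.2).2.2.2
    rwa [← h1.1.2, (hδ₁ s hsδ).1.2.1.1] at h2
  have hJball : J ⊆ Metric.ball t (δ / 2) := by
    intro s hs
    by_contra hcon
    rw [Metric.mem_ball, Real.dist_eq, not_lt] at hcon
    have hmem : ∀ r : ℝ, |r - t| = δ / 2 → r ∉ J := by
      intro r hr hrJ
      have := hloc r hrJ (by rw [Metric.mem_ball, Real.dist_eq, hr]; linarith)
      rw [Metric.mem_ball, Real.dist_eq, hr] at this
      exact lt_irrefl _ this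
    rcases le_abs.mp hcon with hc | hc
    · exact hmem (t + δ / 2) (by rw [add_sub_cancel_left, abs_of_pos (half_pos hδ)])
        (hJo.out htJ hs ⟨by linarith, by linarith⟩)
    · exact hmem (t - δ / 2) (by rw [sub_sub_cancel_left, abs_neg, abs_of_pos (half_pos hδ)])
        (hJo.out hs htJ ⟨by linarith, by linarith⟩)
  intro s₁ hs₁ s₂ hs₂ h12
  have hsub : Icc s₁ s₂ ⊆ J := hJo.out hs₁ hs₂
  have hsubδ : ∀ s ∈ Icc s₁ s₂, s ∈ Metric.ball t δ := fun s hs => hball (hJball (hsub hs))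
  have ha : a ≤ s₁ := (hJs hs₁).1.1
  have hb : s₂ ≤ b := (hJs hs₂).1.2
  refine S.isUniqueMaximizer_of_calibration (x₀ := γ t) (B := Metric.ball (X t) ρ) (θ := θ)
    (F := F) (P := P) (δ := δ) h0
    (fun p hp => hp) hlip (fun x hx => (hB x hx).1.1) (fun x hx => (hB x hx).1.2.2)
    (fun x hx => (hB x hx).2.1) (fun x hx => ⟨(hB x hx).1.2.1, hball (hB x hx).2.2.2⟩)
    (fun s hs => ⟨(hδ₁ s hs).1.1.continuousAt, (hδ₁ s hs).1.2.1⟩)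
    (hsubδ _ (left_mem_Icc.mpr h12.le)) (hsubδ _ (right_mem_Icc.mpr h12.le)) h12
    (fun s hs => ⟨(hJs (hsub hs)).2, ((hδ₁ s (hsubδ s hs)).2 (hJs (hsub hs)).1).1.2⟩)
    (fun s hs => ?_) (fun s hs => ?_) (hfd.isNonspacelikeFDCurve S ha hb)
  · exact ((hδ₁ s (hsubδ s (Ioo_subset_Icc_self hs))).2
      (hJs (hsub (Ioo_subset_Icc_self hs))).1).2 ⟨ha.trans_lt hs.1, hs.2.trans_le hb⟩
  · have h1 := hδ₁ s (hsubδ s (Ioo_subset_Icc_self hs))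
    have h2 := (h1.2 (hJs (hsub (Ioo_subset_Icc_self hs))).1).1
    rw [← S.chartHamiltonian_extChartAt h2.1, ← h2.2]
    exact h1.1.2.2
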